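/- Let $\mathcal L$ be a one-sorted first-order language and $\mathbf M=(M;\dots)$ an $\mathcal L$-structure. "Definable" means definable in $\mathbf M$ with parameters from $M$; "$0$-definable" means definable without parameters. A map is definable if its graph is. **Fubini measures.** $\operatorname{Def}(\mathbf M)$ is the category whose objects are the definable sets $X\subseteq M^m$ ($m\in\mathbb N$; $m$ is part of the object) and whose morphisms are the definable maps. A full subcategory $\mathcal C$ of $\operatorname{Def}(\mathbf M)$ is called *admissible* here if for all $X,Y\in\mathcal C$: (a) if $X,Y\subseteq M^m$, then $X\cup Y\in\mathcal C$; (b) every definable subset of $X$ is in $\mathcal C$; (c) $X\times Y\in\mathcal C$ (as a subset of $M^{m+n}$, for $X\subseteq M^m$, $Y\subseteq M^n$). Let $A$ be a commutative semiring (with $0$, $1$, and $0\cdot a=0$). An *$A$-valued Fubini measure* on an admissible $\mathcal C$ is a map $\mu:\mathcal C\to A$ such that for all $X,Y\in\mathcal C$: * $\mu(X)=0$ if $X=\emptyset$, and $\mu(X)=1$ if $X$ is a singleton; * $\mu(X\cup Y)=\mu(X)+\mu(Y)$ if $X,Y\subseteq M^m$ are disjoint; * for every definable map $f:X\to Y$: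 (F1) the set $\{\mu(f^{-1}(y)):y\in Y\}$ is finite; (F2) for every $a\in A$ the set $\{y\in Y:\mu(f^{-1}(y))=a\}$ is definable; (F3) if $a\in A$ and $\mu(f^{-1}(y))=a$ for all $y\in Y$, then $\mu(X)=a\,\mu(Y)$. **Fiberability.** Let $C\subseteq M$ be $0$-definable with at least two elements. $\operatorname{Def}(C)$ is the full subcategory of $\operatorname{Def}(\mathbf M)$ whose objects are the definable subsets of the powers $C^n$; it is admissible. For a map $f$ with domain $D\subseteq M^{k}\times Q$ and $x\in M^{k}$, let $f(x,-)$ be the map $q\mapsto f(x,q)$ with domain $\{q\in Q:(x,q)\in D\}$. For a definable $X\subseteq M^m$, an *$r$-step fibering of $X$ over $C$* is a tuple $(f_1,\dots,f_{r+1};m_1,\dots,m_r,n_1,\dots,n_{r+1})$ where the $m_j,n_j$ are natural numbers and, for $j=1,\dots,r+1$, $f_j:X_j\to M^{n_j}$ is a definable map with definable domain $$X_j\subseteq M^{m_1}\times\cdots\times M^{m_{j-1}}\times M^{m+n_1+\cdots+n_{j-1}},\qquad X_1=X,$$ such that, by recursion on $r$: if $r=0$, then $f_1$ is injective and $f_1(X)\subseteq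 C^{n_1}$; if $r\ge1$, then for every $y\in f_1(X)$ there is an $x\in M^{m_1}$ such that $(f_2(x,-),\dots,f_{r+1}(x,-);m_2,\dots,m_r,n_2,\dots,n_{r+1})$ is an $(r-1)$-step fibering of $f_1^{-1}(y)\times f_1(X)\subseteq M^{m+n_1}$ over $C$. The set $X$ is *$r$-step fiberable over $C$* if it has an $r$-step fibering over $C$, and $\operatorname{Def}(C)^{\mathrm f}$ is the full subcategory of $\operatorname{Def}(\mathbf M)$ whose objects are the definable sets that are $r$-step fiberable over $C$ for some $r\in\mathbb N$. $C$ is *stably embedded in $\mathbf M$* if for all $m,n$ and every $0$-definable $\mathcal S\subseteq M^m\times M^n$ there are $k\in\mathbb N$ and a $0$-definable $\mathcal T\subseteq M^k\times M^n$ such that for every $p\in M^m$ there is a $c\in C^k$ with $\mathcal S(p)\cap C^n=\mathcal T(c)\cap C^n$, where $\mathcal S(p)=\{q:(p,q)\in\mathcal S\}$ and likewise for $\mathcal T(c)$. **Theorem.** Suppose $C$ is stably embedded in $\mathbf M$. Then $\operatorname{Def}(C)^{\mathrm f}$ contains $\operatorname{Def}(C)$ and is admissible, and for every commutative semiring $A$,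 every $A$-valued Fubini measure on $\operatorname{Def}(C)$ extends uniquely to an $A$-valued Fubini measure on $\operatorname{Def}(C)^{\mathrm f}$. -/

import Mathlib

universe u v w t

namespace FubiniExt


/-- An `M`-tuple version of the cartesian product: `X × Y ⊆ M^(m+n)` for `X ⊆ M^m`, `Y ⊆ M^n`. -/
def prodSet {M : Type w} {m n : ℕ} (X : Set (Fin m → M)) (Y : Set (Fin n → M)) :
    Set (Fin (m + n) → M) :=
  {z | (fun i => z (Fin.castAdd n i)) ∈ X ∧ (fun j => z (Fin.natAdd m j)) ∈ Y}

section

variable (L : FirstOrder.Language.{u, v}) (M : Type w) [L.Structure M]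

/-- The objects of the category `Def(M)` that live in `M^m`: the subsets of `M^m` that are
definable in `M` with parameters from `M`. -/
abbrev DefSet (m : ℕ) : Type w := L.DefinableSet (Set.univ : Set M) (Fin m)

/-- A full subcategory of `Def(M)`, given by its objects; the ambient power `M^m` is part of the
object, so the objects are specified separately in each `M^m`. -/
abbrev ObjClass : Type w := ∀ m : ℕ, Set (DefSet L M m)

end

section

variable {L : FirstOrder.Language.{u, v}} {M : Type w} [L.Structure M]

theorem definable_prodSet {B : Set M} {m n : ℕ} {X : Set (Fin m → M)} {Y : Set (Fin n → M)}
    (hX : B.Definable L X) (hY : B.Definable L Y) : B.Definable L (prodSet X Y) :=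
  (hX.preimage_comp (Fin.castAdd n)).inter (hY.preimage_comp (Fin.natAdd m))

/-- The product `X × Y ⊆ M^(m+n)` as an object of `Def(M)`. -/
def DefSet.prod {m n : ℕ} (X : DefSet L M m) (Y : DefSet L M n) : DefSet L M (m + n) :=
  ⟨prodSet (X : Set (Fin m → M)) (Y : Set (Fin n → M)), definable_prodSet X.2 Y.2⟩

/-- The standing conditions on a full subcategory of `Def(M)`: closure under unions inside one
`M^m`, under definable subsets, and under products. -/
structure IsAdmissible (𝒞 : ObjClass L M) : Prop where
  union_mem : ∀ {m : ℕ} (X Y : DefSet L M m), X ∈ 𝒞 m → Y ∈ 𝒞 m → X ⊔ Y ∈ 𝒞 m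
  subset_mem : ∀ {m : ℕ} (X Y : DefSet L M m), X ∈ 𝒞 m → Y ≤ X → Y ∈ 𝒞 m
  prod_mem : ∀ {m n : ℕ} (X : DefSet L M m) (Y : DefSet L M n),
    X ∈ 𝒞 m → Y ∈ 𝒞 n → X.prod Y ∈ 𝒞 (m + n)

/-- A map `f : X → Y` between definable sets is definable (is a morphism of `Def(M)`) if its graph
is definable with parameters. -/
def IsDefMap {m n : ℕ} {X : DefSet L M m} {Y : DefSet L M n} (f : X → Y) : Prop :=
  (Set.univ : Set M).Definable L
    {z : Fin m ⊕ Fin n → M | ∃ x : X, z = Sum.elim (x : Fin m → M) (f x : Fin n → M)}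

/-- The fiber `f⁻¹(y)`, as a subset of `M^m`. -/
def fiber {m n : ℕ} {X : DefSet L M m} {Y : DefSet L M n} (f : X → Y) (y : Y) :
    Set (Fin m → M) :=
  {v | ∃ x : X, f x = y ∧ (x : Fin m → M) = v}

/-- `S` is an object of `𝒞` and `μ(S) = a`. -/
def HasValue {A : Type*} {𝒞 : ObjClass L M} (μ : ∀ m, 𝒞 m → A) {m : ℕ}
    (S : Set (Fin m → M)) (a : A) : Prop :=
  ∃ F : 𝒞 m, ((F : DefSet L M m) : Set (Fin m → M)) = S ∧ μ m F = a

/-- `μ : 𝒞 → A` is an `A`-valued Fubini measure. (When `𝒞` is admissible, the fibers of a morphism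
of `𝒞` are objects of `𝒞`, so that they have exactly one value.) -/
structure IsFubiniMeasure {A : Type*} [CommSemiring A] (𝒞 : ObjClass L M)
    (μ : ∀ m, 𝒞 m → A) : Prop where
  empty : ∀ {m : ℕ} (X : 𝒞 m), ((X : DefSet L M m) : Set (Fin m → M)) = ∅ → μ m X = 0
  singleton : ∀ {m : ℕ} (X : 𝒞 m) (v : Fin m → M),
    ((X : DefSet L M m) : Set (Fin m → M)) = {v} → μ m X = 1
  union : ∀ {m : ℕ} (X Y Z : 𝒞 m), Disjoint (X : DefSet L M m) (Y : DefSet L M m) →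
    (Z : DefSet L M m) = (X : DefSet L M m) ⊔ (Y : DefSet L M m) → μ m Z = μ m X + μ m Y
  /-- On the fibers of a morphism, `μ` takes only finitely many values. -/
  finite_values : ∀ {m n : ℕ} (X : 𝒞 m) (Y : 𝒞 n) (f : X.1 → Y.1), IsDefMap f →
    {a : A | ∃ y : Y.1, HasValue μ (fiber f y) a}.Finite
  /-- For each `a`, the set of points whose fiber has measure `a` is definable. -/
  definable_values : ∀ {m n : ℕ} (X : 𝒞 m) (Y : 𝒞 n) (f : X.1 → Y.1), IsDefMap f → ∀ a : A,
    (Set.univ : Set M).Definable L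
      {v : Fin n → M | ∃ y : Y.1, (y : Fin n → M) = v ∧ HasValue μ (fiber f y) a}
  /-- If all fibers have measure `a`, then the measures of source and target are related. -/
  fubini : ∀ {m n : ℕ} (X : 𝒞 m) (Y : 𝒞 n) (f : X.1 → Y.1), IsDefMap f → ∀ a : A,
    (∀ y : Y.1, HasValue μ (fiber f y) a) → μ m X = a * μ n Y

end

section

variable (L : FirstOrder.Language.{u, v}) {M : Type w} [L.Structure M]

/-- `C` is stably embedded in `M`: for every 0-definable family of subsets of `M^n` there is a
0-definable family, such that each trace on `C^n` of a member of the first family is the trace on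
`C^n` of a member of the second family with parameters from `C`. -/
def StablyEmbedded (C : Set M) : Prop :=
  ∀ (m n : ℕ) (S : Set (Fin m ⊕ Fin n → M)), (∅ : Set M).Definable L S →
    ∃ (k : ℕ) (T : Set (Fin k ⊕ Fin n → M)), (∅ : Set M).Definable L T ∧
      ∀ p : Fin m → M, ∃ c : Fin k → M, (∀ i, c i ∈ C) ∧
        ∀ q : Fin n → M, (∀ j, q j ∈ C) → (Sum.elim p q ∈ S ↔ Sum.elim c q ∈ T)

/-- `Def(C)`: the definable subsets of the powers `C^n`. -/
def DefOver (C : Set M) : ObjClass L M :=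
  fun _ => {X | ∀ v ∈ X, ∀ i, v i ∈ C}

variable (M)

/-- A definable map `f : D → M^n` with domain `D ⊆ M^p × M^m`, viewed as the definable family of
the partial maps `f(a, -)` from `M^m` to `M^n`, for `a ∈ M^p`. -/
structure DefFamily (p m n : ℕ) : Type w where
  toFun : (Fin p → M) → (Fin m → M) →. (Fin n → M)
  definable : (Set.univ : Set M).Definable L
    {z : (Fin p ⊕ Fin m) ⊕ Fin n → M |
      (fun k => z (Sum.inr k)) ∈
        toFun (fun i => z (Sum.inl (Sum.inl i))) (fun j => z (Sum.inl (Sum.inr j)))}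

/-- `FiberingTuple L M r p m` is the type of tuples `(f₁, …, f_{r+1}; m₁, …, m_r, n₁, …, n_{r+1})`
where `f_j` is a definable map to `M^(n_j)` with domain contained in
`M^p × M^(m₁) × ⋯ × M^(m_{j-1}) × M^(m + n₁ + ⋯ + n_{j-1})`.
In `step`, the numbers `n` and `k` are `n₁` and `m₁`. -/
inductive FiberingTuple : ℕ → ℕ → ℕ → Type w
  | base {p m n : ℕ} (f : DefFamily L M p m n) : FiberingTuple 0 p m
  | step {r p m n k : ℕ} (f : DefFamily L M p m n) (rest : FiberingTuple r (p + k) (m + n)) :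
      FiberingTuple (r + 1) p m

variable {L M}

/-- For a tuple of maps with parameters in `M^p` and for `a ∈ M^p`: the tuple
`(f₁(a, -), …, f_{r+1}(a, -); m₁, …, m_r, n₁, …, n_{r+1})` is an `r`-step fibering of `X ⊆ M^m`
over `C`. -/
def FiberingTuple.IsFibering (C : Set M) :
    {r p m : ℕ} → FiberingTuple L M r p m → (Fin p → M) → Set (Fin m → M) → Prop
  | _, _, _, .base f, a, X =>
      (f.toFun a).Dom = X ∧
      (∀ x x' y, y ∈ f.toFun a x → y ∈ f.toFun a x' → x = x') ∧
      (∀ y ∈ (f.toFun a).ran, ∀ i, y i ∈ C)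
  | _, _, _, .step (k := k) f rest, a, X =>
      (f.toFun a).Dom = X ∧
      ∀ y ∈ (f.toFun a).ran, ∃ x : Fin k → M,
        rest.IsFibering C (Fin.append a x)
          (prodSet ((f.toFun a).preimage {y}) (f.toFun a).ran)

/-- `X` is `r`-step fiberable over `C`: it has an `r`-step fibering (without parameter variables)
over `C`. -/
def IsStepFiberable (C : Set M) (r : ℕ) {m : ℕ} (X : DefSet L M m) : Prop :=
  ∃ D : FiberingTuple L M r 0 m, D.IsFibering C Fin.elim0 (X : Set (Fin m → M))

variable (L)

/-- `Def(C)^f`: the definable sets that are `r`-step fiberable over `C` for some `r`. -/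
def DefFiberable (C : Set M) : ObjClass L M :=
  fun _ => {X | ∃ r : ℕ, IsStepFiberable C r X}

end

end FubiniExt

/-! The measure is extended one fibering step at a time. Suppose `ν` measures the `r`-fiberable
sets, and `f` maps `X` to an `r`-fiberable set `Y` with uniformly `r`-fiberable fibers. The Fubini
axioms force the measure of `X` to be the integral over `Y` of `ν (X ∩ f ⁻¹' {y})`, a finite sum
because the integrand has finitely many values and definable level sets. This gives uniqueness
(`IsFubiniMeasure.val_eq_measureSeq`).

For existence the integral must not depend on `f`. If `g` is another such map, to `Z`, both
integrals equal the double integral of `ν` of `X ∩ f ⁻¹' {y} ∩ g ⁻¹' {z}`, taken in the two orders.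
These agree by Fubini on the `r`-fiberable set `Y × Z` (`IsMeasure.integ_swap`,
`IsFibration.integ_eq`). The same interchange yields (F3) for the extension
(`IsMeasure.stepMeasure_fubini`). An `r`-fiberable set fibers over a point, so the new measure
agrees with `ν` and the levels can be glued.

Conditions (F1) and (F2) concern families, so the induction runs over definable families whose
members are fiberable by members of one definable family of maps (`UF`). A fibering uses the same
maps for all products of a fiber with the range; `UF` asks instead for uniformity of the fibers and
of the ranges separately. The two notions agree on single sets (`isStepFiberable_iff`): each factor
embeds in the product once a point of the other is fixed, and `UF` is stable under products.
Stability of `UF` under uniform injections (`UF.of_injOn`) and products also gives admissibility.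

Stable embeddedness enters at level 0. The images in `C^n` of the members of a family can be indexed
by tuples from `C`, so they are fibers of one projection inside `Def(C)`, to which (F1) and (F2) for
the given measure apply (`IsFubiniMeasure.baseMeasure_simple`). -/

namespace FubiniExt

open Set

/-! ### Calculus of definable predicates and definable maps on types of tuples. -/

/-- A type of tuples from `M`: a type identified with a finite power of `M`. -/
class Coord (M : outParam (Type w)) (E : Type w) where
  ι : Type
  [finite : Finite ι]
  e : E ≃ (ι → M)

attribute [instance] Coord.finite

instance (M : Type w) : Coord M M := ⟨Unit, (Equiv.funUnique Unit M).symm⟩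

instance (M : Type w) (n : ℕ) : Coord M (Fin n → M) := ⟨Fin n, Equiv.refl _⟩

instance (M E F : Type w) [Coord M E] [Coord M F] : Coord M (E × F) :=
  ⟨Coord.ι E ⊕ Coord.ι F,
    (Equiv.prodCongr Coord.e Coord.e).trans (Equiv.sumArrowEquivProdArrow _ _ _).symm⟩

section

variable (L : FirstOrder.Language.{u, v}) {M : Type w} [L.Structure M]
variable {E F G H : Type w} [Coord M E] [Coord M F] [Coord M G] [Coord M H]

/-- A predicate on a type of tuples that is definable with parameters. -/
@[fun_prop]
def DefPred (p : E → Prop) : Prop :=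
  (univ : Set M).Definable L {v : Coord.ι E → M | p (Coord.e.symm v)}

variable {L}

theorem DefPred.congr {p q : E → Prop} (hp : DefPred L p) (h : ∀ x, p x ↔ q x) : DefPred L q := by
  rwa [← funext fun x => propext (h x)]

@[fun_prop]
theorem DefPred.const (p : Prop) : DefPred L fun _ : E => p := by
  by_cases h : p <;> simp [DefPred, h]

@[fun_prop]
theorem DefPred.and {p q : E → Prop} (hp : DefPred L p) (hq : DefPred L q) :
    DefPred L fun x => p x ∧ q x := Definable.inter hp hq

@[fun_prop]
theorem DefPred.or {p q : E → Prop} (hp : DefPred L p) (hq : DefPred L q) :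
    DefPred L fun x => p x ∨ q x := Definable.union hp hq

@[fun_prop]
theorem DefPred.not {p : E → Prop} (hp : DefPred L p) : DefPred L fun x => ¬ p x :=
  Definable.compl hp

theorem DefPred.imp {p q : E → Prop} (hp : DefPred L p) (hq : DefPred L q) :
    DefPred L fun x => p x → q x := by
  refine (hp.not.or hq).congr fun x => ?_
  tauto

@[fun_prop]
theorem DefPred.iff {p q : E → Prop} (hp : DefPred L p) (hq : DefPred L q) :
    DefPred L fun x => p x ↔ q x := by
  refine ((hp.imp hq).and (hq.imp hp)).congr fun x => ?_
  tauto

@[fun_prop]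
theorem DefPred.ex {p : E → F → Prop} (hp : DefPred L fun z : E × F => p z.1 z.2) :
    DefPred L fun x => ∃ y, p x y := by
  have := Definable.image_comp (α := Coord.ι E) hp Sum.inl
  unfold DefPred
  convert this using 1
  ext v
  simp only [mem_ofPred_eq, mem_image]
  constructor
  · rintro ⟨y, hy⟩
    exact ⟨Sum.elim v (Coord.e y), by simpa [Coord.e, Equiv.sumArrowEquivProdArrow] using hy, rfl⟩
  · rintro ⟨u, hu, rfl⟩
    exact ⟨Coord.e.symm (u ∘ Sum.inr), hu⟩

theorem DefPred.all {p : E → F → Prop} (hp : DefPred L fun z : E × F => p z.1 z.2) :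
    DefPred L fun x => ∀ y, p x y := by
  refine (DefPred.ex (p := fun x y => ¬ p x y) hp.not).not.congr fun x => ?_
  simp

theorem DefPred.preimage_reindex {p : F → Prop} (hp : DefPred L p) {f : E → F}
    (σ : Coord.ι F → Coord.ι E) (h : ∀ x j, Coord.e (f x) j = Coord.e x (σ j)) :
    DefPred L fun x => p (f x) := by
  unfold DefPred at *
  convert hp.preimage_comp σ using 1
  ext v
  simp only [mem_ofPred_eq, mem_preimage]
  have : f (Coord.e.symm v) = Coord.e.symm (v ∘ σ) := by
    apply Coord.e.injective
    ext j
    simp [h]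
  rw [this]

theorem DefPred.eq_id : DefPred L fun z : E × E => z.1 = z.2 := by
  have : ∀ i : Coord.ι E, (univ : Set M).Definable L
      {v : Coord.ι (E × E) → M | v (Sum.inl i) = v (Sum.inr i)} := fun i =>
    Definable.mono (A := ∅) (empty_definable_iff.2
      ⟨(FirstOrder.Language.Term.var (Sum.inl i)).equal (FirstOrder.Language.Term.var (Sum.inr i)), by
        ext v; simp⟩) (empty_subset _)
  have := definable_iInter_of_finite this
  unfold DefPred
  convert this using 1
  ext v
  simp only [mem_ofPred_eq, mem_iInter]
  rw [← Coord.e.injective.eq_iff (a := (Coord.e.symm v : E × E).1), funext_iff]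
  refine forall_congr' fun i => ?_
  simp [Coord.e, Equiv.sumArrowEquivProdArrow]

variable (L) in
/-- A map between types of tuples whose graph is definable with parameters. -/
@[fun_prop]
def DefFun (f : E → F) : Prop := DefPred L fun z : E × F => f z.1 = z.2

theorem DefFun.of_reindex {f : E → F} (σ : Coord.ι F → Coord.ι E)
    (h : ∀ x j, Coord.e (f x) j = Coord.e x (σ j)) : DefFun L f := by
  refine DefPred.preimage_reindex (f := fun z : E × F => (f z.1, z.2)) DefPred.eq_id
    (Sum.elim (Sum.inl ∘ σ) Sum.inr) ?_
  rintro ⟨x, y⟩ (j | j)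
  · exact h x j
  · rfl

@[fun_prop]
theorem DefPred.comp {p : F → Prop} {f : E → F} (hp : DefPred L p) (hf : DefFun L f) :
    DefPred L fun x => p (f x) := by
  have h2 : DefPred L fun z : E × F => p z.2 := hp.preimage_reindex Sum.inr fun _ _ => rfl
  exact (DefPred.ex (p := fun x y => f x = y ∧ p y) (DefPred.and (p := fun z : E × F => f z.1 = z.2)
    hf h2)).congr fun x => by simp

@[fun_prop]
theorem DefFun.id : DefFun L fun x : E => x := .of_reindex _root_.id fun _ _ => rfl

@[fun_prop]
theorem DefFun.comp {f : F → G} {g : E → F} (hf : DefFun L f) (hg : DefFun L g) :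
    DefFun L fun x => f (g x) := by
  have h1 : DefPred L fun z : (E × G) × F => g z.1.1 = z.2 :=
    DefPred.preimage_reindex (f := fun z : (E × G) × F => (z.1.1, z.2)) hg
      (Sum.elim (Sum.inl ∘ Sum.inl) Sum.inr) (by rintro _ (_ | _) <;> rfl)
  have h2 : DefPred L fun z : (E × G) × F => f z.2 = z.1.2 :=
    DefPred.preimage_reindex (f := fun z : (E × G) × F => (z.2, z.1.2)) hf
      (Sum.elim Sum.inr (Sum.inl ∘ Sum.inr)) (by rintro _ (_ | _) <;> rfl)
  exact (DefPred.ex (p := fun (x : E × G) y => g x.1 = y ∧ f y = x.2) (h1.and h2)).congr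
    fun x => by simp

@[fun_prop]
theorem DefFun.fst_id : DefFun L (Prod.fst : E × F → E) := .of_reindex Sum.inl fun _ _ => rfl

@[fun_prop]
theorem DefFun.snd_id : DefFun L (Prod.snd : E × F → F) := .of_reindex Sum.inr fun _ _ => rfl

@[fun_prop]
theorem DefFun.fst {f : E → F × G} (hf : DefFun L f) : DefFun L fun x => (f x).1 :=
  DefFun.fst_id.comp hf

@[fun_prop]
theorem DefFun.snd {f : E → F × G} (hf : DefFun L f) : DefFun L fun x => (f x).2 :=
  DefFun.snd_id.comp hf

@[fun_prop]
theorem DefFun.prodMk {f : E → F} {g : E → G} (hf : DefFun L f) (hg : DefFun L g) :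
    DefFun L fun x => (f x, g x) := by
  have h1 : DefPred L fun z : E × (F × G) => f z.1 = z.2.1 :=
    DefPred.preimage_reindex (f := fun z : E × (F × G) => (z.1, z.2.1)) hf
      (Sum.elim Sum.inl (Sum.inr ∘ Sum.inl)) (by rintro _ (_ | _) <;> rfl)
  have h2 : DefPred L fun z : E × (F × G) => g z.1 = z.2.2 :=
    DefPred.preimage_reindex (f := fun z : E × (F × G) => (z.1, z.2.2)) hg
      (Sum.elim Sum.inl (Sum.inr ∘ Sum.inr)) (by rintro _ (_ | _) <;> rfl)
  exact (h1.and h2).congr fun x => by simp [Prod.ext_iff]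

@[fun_prop]
theorem DefPred.eq {f g : E → F} (hf : DefFun L f) (hg : DefFun L g) :
    DefPred L fun x => f x = g x :=
  DefPred.comp (f := fun x => (f x, g x)) DefPred.eq_id (hf.prodMk hg)

theorem DefPred.eq_const (a : E) : DefPred L fun x : E => x = a := by
  have : ∀ i : Coord.ι E, (univ : Set M).Definable L
      {v : Coord.ι E → M | v i = Coord.e a i} := fun i =>
    ⟨(FirstOrder.Language.Term.var i).equal
      (L.con (⟨Coord.e a i, mem_univ _⟩ : (univ : Set M))).term, by ext v; simp⟩
  have := definable_iInter_of_finite this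
  unfold DefPred
  convert this using 1
  ext v
  simp only [mem_ofPred_eq, mem_iInter, Equiv.symm_apply_eq, funext_iff]

@[fun_prop]
theorem DefFun.const (a : F) : DefFun L fun _ : E => a :=
  (DefPred.comp (f := fun z : E × F => z.2) (DefPred.eq_const a) (by fun_prop)).congr
    fun x => eq_comm

theorem DefFun.ite {p : E → Prop} [DecidablePred p] {f g : E → F} (hp : DefPred L p)
    (hf : DefFun L f) (hg : DefFun L g) : DefFun L fun x => if p x then f x else g x := by
  have : DefPred L fun z : E × F => (p z.1 ∧ f z.1 = z.2) ∨ (¬ p z.1 ∧ g z.1 = z.2) := by fun_prop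
  refine this.congr fun z => ?_
  by_cases h : p z.1 <;> simp [h]

theorem DefPred.forall_finite {ι : Type*} [Finite ι] {p : ι → E → Prop}
    (hp : ∀ i, DefPred L (p i)) : DefPred L fun x => ∀ i, p i x := by
  unfold DefPred
  convert definable_iInter_of_finite hp using 1
  ext v
  simp

theorem DefPred.exists_finset {ι : Type*} {p : ι → E → Prop} (s : Finset ι)
    (hp : ∀ i ∈ s, DefPred L (p i)) : DefPred L fun x => ∃ i ∈ s, p i x := by
  unfold DefPred
  convert definable_biUnion_finset (f := fun i : s => {v | p i (Coord.e.symm v)})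
    (fun i => hp i i.2) Finset.univ using 1
  ext v
  simp

theorem DefFun.coord (i : Coord.ι E) : DefFun L fun x : E => Coord.e x i :=
  .of_reindex (fun _ => i) fun _ _ => rfl

@[fun_prop]
theorem DefFun.apply {n : ℕ} (i : Fin n) : DefFun L fun x : Fin n → M => x i :=
  DefFun.coord (E := Fin n → M) i

@[fun_prop]
theorem DefFun.pi {n : ℕ} {f : E → Fin n → M} (hf : ∀ i, DefFun L fun x => f x i) :
    DefFun L fun x i => f x i := by
  have : DefPred L fun z : E × (Fin n → M) => ∀ i, f z.1 i = z.2 i :=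
    DefPred.forall_finite fun i => DefPred.eq ((hf i).comp DefFun.fst_id) (by fun_prop)
  exact this.congr fun z => funext_iff.symm

@[fun_prop]
theorem DefFun.append {m n : ℕ} {f : E → Fin m → M} {g : E → Fin n → M} (hf : DefFun L f)
    (hg : DefFun L g) : DefFun L fun x => Fin.append (f x) (g x) := by
  have : DefFun L fun z : (Fin m → M) × (Fin n → M) => Fin.append z.1 z.2 := by
    refine .of_reindex finSumFinEquiv.symm fun z j => ?_
    induction j using Fin.addCases with
    | left j => simp [Coord.e, Equiv.sumArrowEquivProdArrow]
    | right j => simp [Coord.e, Equiv.sumArrowEquivProdArrow]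
  exact this.comp (hf.prodMk hg)

/-- Carries auxiliary index and value types back to the powers `Fin n → M`, where fibering tuples
and objects of `Def(M)` live. -/
theorem exists_equiv_fin (L : FirstOrder.Language.{u, v}) {M : Type w} [L.Structure M]
    (E : Type w) [Coord M E] :
    ∃ (n : ℕ) (e : E ≃ (Fin n → M)), DefFun L e ∧ DefFun L e.symm := by
  obtain ⟨n, ⟨σ⟩⟩ := Finite.exists_equiv_fin (Coord.ι E)
  refine ⟨n, Coord.e.trans (Equiv.arrowCongr σ (Equiv.refl _)), .of_reindex σ.symm ?_,
    .of_reindex σ ?_⟩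
  · intro x j
    rfl
  · intro x j
    simp [Coord.e]

theorem defPred_mem_iff {n : ℕ} {S : Set (Fin n → M)} :
    DefPred L (· ∈ S) ↔ (univ : Set M).Definable L S := Iff.rfl

theorem defPred_sumElim_iff {m n : ℕ} {S : Set (Fin m ⊕ Fin n → M)} :
    DefPred L (fun z : (Fin m → M) × (Fin n → M) => Sum.elim z.1 z.2 ∈ S) ↔
      (univ : Set M).Definable L S := by
  unfold DefPred
  have : {v : Fin m ⊕ Fin n → M | Sum.elim (v ∘ Sum.inl) (v ∘ Sum.inr) ∈ S} = S := by
    ext v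
    simp
  exact iff_of_eq (congrArg _ this)

end

/-! ### Uniformly fiberable families and their closure properties. -/

section

variable (L : FirstOrder.Language.{u, v}) {M : Type w} [L.Structure M] (C : Set M)
variable {P P' Q E E' F : Type w} [Coord M P] [Coord M P'] [Coord M Q] [Coord M E] [Coord M E']
  [Coord M F]

/-- The member with index `p` of a family of sets. -/
def slice {P E : Type*} (S : Set (P × E)) (p : P) : Set E := {x | (p, x) ∈ S}

@[simp]
theorem mem_slice {P E : Type*} {S : Set (P × E)} {p : P} {x : E} :
    x ∈ slice S p ↔ (p, x) ∈ S := Iff.rfl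

/-- The family of the fibers of the maps `f(q, -)` on the sets `D(q)`. -/
def fibers {Q E F : Type*} (f : Q × E → F) (D : Set (Q × E)) : Set ((Q × F) × E) :=
  {z | (z.1.1, z.2) ∈ D ∧ f (z.1.1, z.2) = z.1.2}

@[simp]
theorem mem_fibers {Q E F : Type*} {f : Q × E → F} {D : Set (Q × E)} {z : (Q × F) × E} :
    z ∈ fibers f D ↔ (z.1.1, z.2) ∈ D ∧ f (z.1.1, z.2) = z.1.2 := Iff.rfl

/-- The family of the images of the sets `D(q)` under the maps `f(q, -)`. -/
def ranges {Q E F : Type*} (f : Q × E → F) (D : Set (Q × E)) : Set (Q × F) :=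
  {z | ∃ x, (z.1, x) ∈ D ∧ f (z.1, x) = z.2}

@[simp]
theorem mem_ranges {Q E F : Type*} {f : Q × E → F} {D : Set (Q × E)} {z : Q × F} :
    z ∈ ranges f D ↔ ∃ x, (z.1, x) ∈ D ∧ f (z.1, x) = z.2 := Iff.rfl

/-- The family of the products of the members of two families. -/
def prodFam {P P' E E' : Type*} (S : Set (P × E)) (S' : Set (P' × E')) :
    Set ((P × P') × (E × E')) :=
  {z | (z.1.1, z.2.1) ∈ S ∧ (z.1.2, z.2.2) ∈ S'}

@[simp]
theorem mem_prodFam {P P' E E' : Type*} {S : Set (P × E)} {S' : Set (P' × E')}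
    {z : (P × P') × (E × E')} :
    z ∈ prodFam S S' ↔ (z.1.1, z.2.1) ∈ S ∧ (z.1.2, z.2.2) ∈ S' := Iff.rfl

/-- A family is uniformly `r`-fiberable over `C` if its nonempty members have `r`-step fiberings
over `C` that are members of one definable family. -/
def UF : ℕ → ∀ {P E : Type w} [Coord M P] [Coord M E], Set (P × E) → Prop
  | 0, _, E, _, _, S => ∃ (Q : Type w) (_ : Coord M Q) (n : ℕ) (f : Q × E → (Fin n → M)),
      DefFun L f ∧ ∀ p, (slice S p).Nonempty → ∃ q, InjOn (fun x => f (q, x)) (slice S p) ∧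
        ∀ x ∈ slice S p, ∀ i, f (q, x) i ∈ C
  | r + 1, _, E, _, _, S => ∃ (Q : Type w) (_ : Coord M Q) (F : Type w) (_ : Coord M F)
      (f : Q × E → F) (D : Set (Q × E)), DefFun L f ∧ DefPred L (· ∈ D) ∧
        (∀ p, (slice S p).Nonempty → ∃ q, slice D q = slice S p) ∧
        UF r (fibers f D) ∧ UF r (ranges f D)

variable {L C}

theorem DefFun.defPred_fibers {f : Q × E → F} {D : Set (Q × E)} (hf : DefFun L f)
    (hD : DefPred L (· ∈ D)) : DefPred L (· ∈ fibers f D) := by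
  simp only [FubiniExt.mem_fibers]
  fun_prop

theorem DefFun.defPred_ranges {f : Q × E → F} {D : Set (Q × E)} (hf : DefFun L f)
    (hD : DefPred L (· ∈ D)) : DefPred L (· ∈ ranges f D) := by
  simp only [FubiniExt.mem_ranges]
  fun_prop

theorem DefPred.injOn_slice {S : Set (P × E)} (hS : DefPred L (· ∈ S)) {g : Q × E → F}
    (hg : DefFun L g) :
    DefPred L fun z : P × Q => InjOn (fun x => g (z.2, x)) (slice S z.1) := by
  have : DefPred L fun z : P × Q => ¬ ∃ x y, (z.1, x) ∈ S ∧ (z.1, y) ∈ S ∧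
      g (z.2, x) = g (z.2, y) ∧ ¬ x = y := by fun_prop
  refine this.congr fun z => ?_
  simp only [InjOn, mem_slice]
  push Not
  exact ⟨fun h x hx y hy => h x y hx hy, fun h x y hx hy => h hx hy⟩

theorem DefPred.mapsTo_slice {S : Set (P × E)} (hS : DefPred L (· ∈ S)) {S' : Set (P' × F)}
    (hS' : DefPred L (· ∈ S')) {g : Q × E → F} (hg : DefFun L g) :
    DefPred L fun z : (P × P') × Q =>
      MapsTo (fun x => g (z.2, x)) (slice S z.1.1) (slice S' z.1.2) := by
  have : DefPred L fun z : (P × P') × Q => ¬ ∃ x, (z.1.1, x) ∈ S ∧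
      ¬ (z.1.2, g (z.2, x)) ∈ S' := by fun_prop
  refine this.congr fun z => ?_
  simp only [MapsTo, mem_slice]
  push Not
  exact Iff.rfl

theorem DefPred.slice_eq {S : Set (P × E)} (hS : DefPred L (· ∈ S)) {S' : Set (P' × E)}
    (hS' : DefPred L (· ∈ S')) :
    DefPred L fun z : P × P' => slice S z.1 = slice S' z.2 := by
  have : DefPred L fun z : P × P' => ¬ ∃ x, ¬ ((z.1, x) ∈ S ↔ (z.2, x) ∈ S') := by fun_prop
  refine this.congr fun z => ?_
  simp only [Set.ext_iff, mem_slice]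
  push Not
  exact Iff.rfl

/-- Uniform fiberability passes to definable families whose members inject uniformly into
members of the given family. -/
theorem UF.of_injOn {r : ℕ} {S : Set (P × E)} (hS : UF L C r S) {S' : Set (P' × E')}
    (hS' : DefPred L (· ∈ S')) {g : Q × E' → E} (hg : DefFun L g)
    (h : ∀ p', (slice S' p').Nonempty → ∃ q p, InjOn (fun x => g (q, x)) (slice S' p') ∧
      MapsTo (fun x => g (q, x)) (slice S' p') (slice S p)) : UF L C r S' := by
  induction r generalizing P P' E E' Q with
  | zero =>
    obtain ⟨Q₀, _, n, f, hf, H⟩ := hS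
    refine ⟨Q₀ × Q, inferInstance, n, fun z => f (z.1.1, g (z.1.2, z.2)), by fun_prop, ?_⟩
    intro p' hp'
    obtain ⟨q, p, hq, hm⟩ := h p' hp'
    obtain ⟨q₀, hi, hc⟩ := H p ((hp'.image fun x => g (q, x)).mono hm.image_subset)
    exact ⟨(q₀, q), hi.comp hq hm, fun x hx => hc _ (hm hx)⟩
  | succ r ih =>
    obtain ⟨Q₀, _, F, _, f, D, hf, hD, H, hfib, hran⟩ := hS
    -- The requirement that `g(q, -)` inject `S'(p')` into `D(q₀)` is part of the domain. Hence the
    -- slice over `(q₀, q, p')` is either empty or all of `S'(p')`, and bad triples contribute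
    -- nothing to the fibers and ranges.
    have hD' : DefPred L fun z : (Q₀ × (Q × P')) × E' => (z.1.2.2, z.2) ∈ S' ∧
        InjOn (fun x => g (z.1.2.1, x)) (slice S' z.1.2.2) ∧
        MapsTo (fun x => g (z.1.2.1, x)) (slice S' z.1.2.2) (slice D z.1.1) := by
      refine .and (by fun_prop) (.and ?_ ?_)
      · exact (DefPred.injOn_slice hS' hg).comp
          (f := fun z : (Q₀ × (Q × P')) × E' => (z.1.2.2, z.1.2.1)) (by fun_prop)
      · exact (DefPred.mapsTo_slice hS' hD hg).comp
          (f := fun z : (Q₀ × (Q × P')) × E' => ((z.1.2.2, z.1.1), z.1.2.1)) (by fun_prop)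
    have hf' : DefFun L fun z : (Q₀ × (Q × P')) × E' => f (z.1.1, g (z.1.2.1, z.2)) := by
      fun_prop
    refine ⟨Q₀ × (Q × P'), inferInstance, F, inferInstance, _, {z | _}, hf', hD', ?_, ?_, ?_⟩
    · intro p' hp'
      obtain ⟨q, p, hq, hm⟩ := h p' hp'
      obtain ⟨q₀, hq₀⟩ := H p (hp'.image (fun x => g (q, x)) |>.mono hm.image_subset)
      refine ⟨(q₀, q, p'), ?_⟩
      ext x
      simp only [mem_slice, mem_ofPred_eq, hq₀]
      tauto
    · refine ih hfib (hf'.defPred_fibers hD') (Q := Q) hg ?_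
      rintro ⟨⟨q₀, q, p'⟩, y⟩ ⟨x₀, ⟨-, hi, hm⟩, -⟩
      refine ⟨q, (q₀, y), hi.mono fun x hx => hx.1.1, fun x hx => ⟨hm hx.1.1, hx.2⟩⟩
    · refine ih hran (hf'.defPred_ranges hD') (Q := Q) (g := fun z => z.2) (by fun_prop) ?_
      rintro ⟨q₀, q, p'⟩ ⟨y₀, x₀, ⟨-, hi, hm⟩, -⟩
      refine ⟨q, q₀, fun x _ y _ h => h, ?_⟩
      rintro y ⟨x, hx, hxy⟩
      exact ⟨g (q, x), hm hx.1, hxy⟩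

/-- Uniform fiberability passes to definable families of subsets of the members. -/
theorem UF.of_subset {r : ℕ} {S : Set (P × E)} (hS : UF L C r S) {S' : Set (P' × E)}
    (hS' : DefPred L (· ∈ S'))
    (h : ∀ p', (slice S' p').Nonempty → ∃ p, slice S' p' ⊆ slice S p) : UF L C r S' := by
  -- The map ignores its index, so any point of the nonempty member can serve as one.
  refine hS.of_injOn (Q := E) hS' (g := fun z => z.2) (by fun_prop) fun p' hp' => ?_
  obtain ⟨p, hp⟩ := h p' hp'
  exact ⟨hp'.some, p, fun x _ y _ h => h, hp⟩

/-- Maps and domains are multiplied: fibers of a product map are products of fibers, and likewise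
for ranges. -/
theorem UF.prod {r : ℕ} {S : Set (P × E)} (hS : UF L C r S)
    {S' : Set (P' × E')} (hS' : UF L C r S') : UF L C r (prodFam S S') := by
  induction r generalizing P P' E E' with
  | zero =>
    obtain ⟨Q, _, n, f, hf, H⟩ := hS
    obtain ⟨Q', _, n', f', hf', H'⟩ := hS'
    refine ⟨Q × Q', inferInstance, n + n',
      fun z => Fin.append (f (z.1.1, z.2.1)) (f' (z.1.2, z.2.2)), by fun_prop, ?_⟩
    rintro ⟨p, p'⟩ ⟨⟨x₀, x₀'⟩, hx₀, hx₀'⟩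
    obtain ⟨q, hi, hc⟩ := H p ⟨x₀, hx₀⟩
    obtain ⟨q', hi', hc'⟩ := H' p' ⟨x₀', hx₀'⟩
    refine ⟨(q, q'), ?_, ?_⟩
    · rintro ⟨x, x'⟩ hx ⟨y, y'⟩ hy h
      have h := (Fin.appendEquiv n n').injective (a₁ := (f (q, x), f' (q', x')))
        (a₂ := (f (q, y), f' (q', y'))) h
      simp only [Prod.mk.injEq] at h
      exact Prod.ext (hi hx.1 hy.1 h.1) (hi' hx.2 hy.2 h.2)
    · rintro ⟨x, x'⟩ hx i
      induction i using Fin.addCases with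
      | left i => simpa using hc x hx.1 i
      | right i => simpa using hc' x' hx.2 i
  | succ r ih =>
    obtain ⟨Q, _, F, _, f, D, hf, hD, H, hfib, hran⟩ := hS
    obtain ⟨Q', _, F', _, f', D', hf', hD', H', hfib', hran'⟩ := hS'
    have hg : DefFun L fun z : (Q × Q') × (E × E') =>
      (f (z.1.1, z.2.1), f' (z.1.2, z.2.2)) := by fun_prop
    have hDD : DefPred L (· ∈ prodFam D D') := by
      simp only [mem_prodFam]
      fun_prop
    refine ⟨Q × Q', inferInstance, F × F', inferInstance, _, prodFam D D', hg, hDD, ?_, ?_, ?_⟩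
    · rintro ⟨p, p'⟩ ⟨⟨x₀, x₀'⟩, hx₀, hx₀'⟩
      obtain ⟨q, hq⟩ := H p ⟨x₀, hx₀⟩
      obtain ⟨q', hq'⟩ := H' p' ⟨x₀', hx₀'⟩
      refine ⟨(q, q'), ?_⟩
      ext ⟨x, x'⟩
      exact and_congr (Set.ext_iff.1 hq x) (Set.ext_iff.1 hq' x')
    · refine (ih hfib hfib').of_subset (hg.defPred_fibers hDD) ?_
      rintro ⟨⟨q, q'⟩, y, y'⟩ -
      refine ⟨((q, y), q', y'), ?_⟩
      rintro ⟨x, x'⟩ ⟨⟨hx, hx'⟩, h⟩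
      simp only [Prod.mk.injEq] at h
      exact ⟨⟨hx, h.1⟩, hx', h.2⟩
    · refine (ih hran hran').of_subset (hg.defPred_ranges hDD) ?_
      rintro ⟨q, q'⟩ -
      refine ⟨(q, q'), ?_⟩
      rintro y ⟨⟨x, x'⟩, ⟨hx, hx'⟩, h⟩
      exact ⟨⟨x, hx, congrArg Prod.fst h⟩, x', hx', congrArg Prod.snd h⟩

/-- The map to the one-point set `M^0` has `S` as its family of fibers. Its range is at most a
point, which is sent to a chosen element of the member of `S`; that element is the index of the
injection. -/
theorem UF.succ {r : ℕ} {S : Set (P × E)} (hdef : DefPred L (· ∈ S)) (hS : UF L C r S) :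
    UF L C (r + 1) S := by
  have hf : DefFun L fun _ : P × E => (Fin.elim0 : Fin 0 → M) := by fun_prop
  refine ⟨P, inferInstance, Fin 0 → M, inferInstance, _, S, hf, hdef, fun p _ => ⟨p, rfl⟩, ?_, ?_⟩
  · exact hS.of_subset (hf.defPred_fibers hdef) fun z _ => ⟨z.1, fun x hx => hx.1⟩
  · refine hS.of_injOn (Q := E) (hf.defPred_ranges hdef) (g := fun z => z.1) (by fun_prop) ?_
    rintro p ⟨y, x, hx, -⟩
    exact ⟨x, p, fun a _ b _ _ => Subsingleton.elim a b, fun _ _ => hx⟩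

theorem UF.mono {r s : ℕ} (hrs : r ≤ s) {S : Set (P × E)} (hdef : DefPred L (· ∈ S))
    (hS : UF L C r S) : UF L C s S := by
  induction s, hrs using Nat.le_induction with
  | base => exact hS
  | succ s _ ih => exact ih.succ hdef

theorem UF.of_empty (r : ℕ) {S : Set (P × E)} (hS : ∀ p, slice S p = ∅) : UF L C r S := by
  induction r generalizing P E with
  | zero =>
    refine ⟨E, inferInstance, 0, fun _ => Fin.elim0, by fun_prop, fun p hp => ?_⟩
    simp [hS p] at hp
  | succ r ih =>
    refine ⟨E, inferInstance, E, inferInstance, fun z => z.2, ∅, by fun_prop, by simp; fun_prop,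
      fun p hp => ?_, ih fun p => ?_, ih fun p => ?_⟩
    · simp [hS p] at hp
    · simp [slice]
    · simp [slice]

variable (L C) in
/-- `r`-fiberability of a single definable set. -/
def Fiberable (r : ℕ) (X : Set E) : Prop :=
  DefPred L (· ∈ X) ∧ UF L C r {z : (Fin 0 → M) × E | z.2 ∈ X}

theorem Fiberable.of_injOn {r : ℕ} {X : Set E} (hX : Fiberable L C r X) {Y : Set F}
    (hY : DefPred L (· ∈ Y)) {g : F → E} (hg : DefFun L g) (hi : InjOn g Y)
    (hm : MapsTo g Y X) : Fiberable L C r Y :=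
  ⟨hY, hX.2.of_injOn (Q := F) (by simp only [mem_ofPred_eq]; fun_prop) (g := fun z => g z.2)
    (by fun_prop) fun p hp => ⟨hp.some, p, hi, hm⟩⟩

theorem Fiberable.subset {r : ℕ} {X Y : Set E} (hX : Fiberable L C r X)
    (hY : DefPred L (· ∈ Y)) (h : Y ⊆ X) : Fiberable L C r Y :=
  hX.of_injOn hY (g := fun x => x) (by fun_prop) (fun _ _ _ _ h => h) h

theorem Fiberable.prod {r : ℕ} {X : Set E} (hX : Fiberable L C r X)
    {Y : Set F} (hY : Fiberable L C r Y) : Fiberable L C r (X ×ˢ Y) := by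
  have hXdef := hX.1
  have hYdef := hY.1
  refine ⟨by simp only [mem_prod]; fun_prop, (hX.2.prod hY.2).of_subset ?_ fun p _ => ⟨(p, p), ?_⟩⟩
  · simp only [mem_prod, mem_ofPred_eq]; fun_prop
  · exact fun z hz => hz

theorem Fiberable.of_family {r : ℕ} {S : Set (P × E)} (hS : UF L C r S)
    {X : Set E} (hX : DefPred L (· ∈ X)) {p : P} (h : X ⊆ slice S p) :
    Fiberable L C r X :=
  ⟨hX, hS.of_subset (by simp only [mem_ofPred_eq]; fun_prop) fun _ _ => ⟨p, h⟩⟩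

/-- Uniformity is automatic inside one fiberable set, since a fibering of `X` restricts to all its
definable subsets. -/
theorem Fiberable.family {r : ℕ} {X : Set E} (hX : Fiberable L C r X)
    {S : Set (P × E)} (hS : DefPred L (· ∈ S)) (h : ∀ p, slice S p ⊆ X) : UF L C r S :=
  hX.2.of_subset hS fun p _ => ⟨Fin.elim0, h p⟩

theorem Fiberable.mono {r s : ℕ} (hrs : r ≤ s) {X : Set E} (hX : Fiberable L C r X) :
    Fiberable L C s X :=
  have := hX.1
  ⟨hX.1, hX.2.mono hrs (by simp only [mem_ofPred_eq]; fun_prop)⟩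

theorem Fiberable.of_empty (r : ℕ) : Fiberable L C r (∅ : Set E) :=
  ⟨by simp; fun_prop, UF.of_empty r fun p => by simp [slice]⟩

theorem Fiberable.of_mem {n : ℕ} {X : Set (Fin n → M)} (hX : DefPred L (· ∈ X))
    (h : ∀ v ∈ X, ∀ i, v i ∈ C) (r : ℕ) : Fiberable L C r X := by
  refine Fiberable.mono (Nat.zero_le r) ⟨hX, Fin 0 → M, inferInstance, n, fun z => z.2, by fun_prop,
    fun p _ => ⟨p, fun x _ y _ h => h, h⟩⟩

theorem Fiberable.singleton (hC : C.Nonempty) (r : ℕ) (x : E) :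
    Fiberable L C r {x} := by
  obtain ⟨c, hc⟩ := hC
  refine (Fiberable.of_mem (n := 1) (X := {fun _ => c}) ?_ ?_ r).of_injOn ?_
    (g := fun _ => fun _ => c) (by fun_prop) ?_ ?_
  · simp only [mem_singleton_iff]; fun_prop
  · simpa using hc
  · simp only [mem_singleton_iff]; fun_prop
  · simp
  · simp

/-- The union embeds in `X × Y × C`: points of `X` are paired with a fixed `y` and the tag `c`, the
others with a fixed `x` and the tag `d`. Two distinct tags are the reason for asking that `C` have
two elements. -/
theorem Fiberable.union (hC : DefPred L (· ∈ C)) (hC₂ : C.Nontrivial) {r : ℕ} {X Y : Set E}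
    (hX : Fiberable L C r X) (hY : Fiberable L C r Y) : Fiberable L C r (X ∪ Y) := by
  rcases X.eq_empty_or_nonempty with rfl | ⟨x, hx⟩
  · simpa using hY
  rcases Y.eq_empty_or_nonempty with rfl | ⟨y, hy⟩
  · simpa using hX
  obtain ⟨c, hc, d, hd, hcd⟩ := hC₂
  have hT : Fiberable L C r (univ.pi fun _ : Fin 1 => C) := by
    refine .of_mem ?_ (by simp) r
    simp only [mem_pi, mem_univ, true_imp_iff]
    exact .forall_finite fun i => by fun_prop
  classical
  have hXd := hX.1
  have hYd := hY.1
  refine ((hX.prod hY).prod hT).of_injOn (by simp only [mem_union]; fun_prop)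
    (g := fun z => if z ∈ X then ((z, y), fun _ => c) else ((x, z), fun _ => d)) ?_ ?_ ?_
  · exact DefFun.ite hXd (by fun_prop) (by fun_prop)
  · intro a _ b _ h
    by_cases ha : a ∈ X <;> by_cases hb : b ∈ X <;> simp [ha, hb, funext_iff] at h
    · exact h
    · exact (hcd h.2).elim
    · exact (hcd h.2.symm).elim
    · exact h
  · intro a ha
    by_cases h : a ∈ X
    · simp [h, hy, hc]
    · simp [h, hx, hd, ha.resolve_left h]

end

/-! ### Simple functions, measures at a fixed level, and integration. -/

section

variable {L : FirstOrder.Language.{u, v}} {M : Type w} [L.Structure M] {C : Set M}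
variable {P Q E F : Type w} [Coord M P] [Coord M Q] [Coord M E] [Coord M F]

variable (L) in
/-- A map with finite range and definable level sets. -/
structure Simple {T : Type*} (φ : E → T) : Prop where
  finite : (range φ).Finite
  def_level : ∀ a, DefPred L fun x => φ x = a

namespace Simple

variable {T T' : Type*}

theorem map {φ : E → T} (hφ : Simple L φ) (h : T → T') : Simple L fun x => h (φ x) := by
  refine ⟨(hφ.finite.image h).subset ?_, fun a => ?_⟩
  · rintro _ ⟨x, rfl⟩
    exact ⟨_, ⟨x, rfl⟩, rfl⟩
  · classical
    refine (DefPred.exists_finset (hφ.finite.toFinset.filter fun b => h b = a)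
      (p := fun b x => φ x = b) fun b _ => hφ.def_level b).congr fun x => ?_
    simp

theorem prodMk {φ : E → T} {ψ : E → T'} (hφ : Simple L φ) (hψ : Simple L ψ) :
    Simple L fun x => (φ x, ψ x) := by
  refine ⟨(hφ.finite.prod hψ.finite).subset ?_, fun a => ?_⟩
  · rintro _ ⟨x, rfl⟩
    exact ⟨⟨x, rfl⟩, x, rfl⟩
  · exact ((hφ.def_level a.1).and (hψ.def_level a.2)).congr fun x => by simp [Prod.ext_iff]

theorem comp {φ : F → T} (hφ : Simple L φ) {g : E → F} (hg : DefFun L g) :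
    Simple L fun x => φ (g x) := by
  refine ⟨hφ.finite.subset ?_, fun a => (hφ.def_level a).comp hg⟩
  rintro _ ⟨x, rfl⟩
  exact ⟨g x, rfl⟩

theorem const (a : T) : Simple L fun _ : E => a :=
  ⟨(finite_singleton a).subset (by rintro _ ⟨x, rfl⟩; rfl), fun _ => by fun_prop⟩

theorem sum {A ι : Type*} [AddCommMonoid A] {φ : ι → E → A} (s : Finset ι)
    (h : ∀ i ∈ s, Simple L (φ i)) : Simple L fun x => ∑ i ∈ s, φ i x := by
  classical
  induction s using Finset.induction_on with
  | empty => simpa using Simple.const (0 : A)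
  | insert i s hi ih =>
    simp only [Finset.sum_insert hi]
    exact ((h i (by simp)).prodMk (ih fun j hj => h j (by simp [hj]))).map fun z => z.1 + z.2

end Simple

variable {A : Type t} [CommSemiring A]

variable (L C) in
/-- A measure on the `r`-fiberable sets, given as a function on all sets. -/
structure IsMeasure (r : ℕ) (ν : ∀ (E : Type w) [Coord M E], Set E → A) : Prop where
  simple : ∀ {P E : Type w} [Coord M P] [Coord M E] {S : Set (P × E)}, DefPred L (· ∈ S) →
    UF L C r S → Simple L fun p => ν E (slice S p)
  empty : ∀ (E : Type w) [Coord M E], ν E ∅ = 0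
  singleton : ∀ {E : Type w} [Coord M E] (x : E), ν E {x} = 1
  union : ∀ {E : Type w} [Coord M E] {X Y : Set E}, Fiberable L C r (X ∪ Y) →
    DefPred L (· ∈ X) → DefPred L (· ∈ Y) → Disjoint X Y → ν E (X ∪ Y) = ν E X + ν E Y
  fubini : ∀ {E F : Type w} [Coord M E] [Coord M F] {X : Set E} {Y : Set F} {f : E → F} {a : A},
    Fiberable L C r X → Fiberable L C r Y → DefFun L f → MapsTo f X Y →
    (∀ y ∈ Y, ν E (X ∩ f ⁻¹' {y}) = a) → ν E X = a * ν F Y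

/-- The integral over `Y` of a function with finite range. -/
noncomputable def integ (ν : ∀ (E : Type w) [Coord M E], Set E → A) (Y : Set E) (φ : E → A) : A :=
  ∑ᶠ a, a * ν E (Y ∩ φ ⁻¹' {a})

theorem integ_congr (ν : ∀ (E : Type w) [Coord M E], Set E → A) {Y : Set E} {φ ψ : E → A}
    (h : ∀ x ∈ Y, φ x = ψ x) : integ ν Y φ = integ ν Y ψ := by
  unfold integ
  congr! 4 with a
  ext x
  simp only [mem_inter_iff, mem_preimage, mem_singleton_iff, and_congr_right_iff]
  exact fun hx => by rw [h x hx]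

theorem defPred_inter_preimage {T : Type*} {X : Set E} (hX : DefPred L (· ∈ X)) {ψ : E → T}
    (hψ : Simple L ψ) (b : T) : DefPred L (· ∈ X ∩ ψ ⁻¹' {b}) :=
  hX.and (hψ.def_level b)

/-- The family of the fibers in `X` of a map. -/
def fiberFam {E F : Type*} (X : Set E) (f : E → F) : Set (F × E) := {z | z.2 ∈ X ∧ f z.2 = z.1}

theorem defPred_fiberFam {X : Set E} (hX : DefPred L (· ∈ X)) {f : E → F} (hf : DefFun L f) :
    DefPred L (· ∈ fiberFam X f) := by
  simp only [fiberFam, mem_ofPred_eq]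
  fun_prop

theorem Fiberable.uf_fiberFam {r : ℕ} {X : Set E} (hX : Fiberable L C r X) {f : E → F}
    (hf : DefFun L f) : UF L C r (fiberFam X f) :=
  hX.family (defPred_fiberFam hX.1 hf) fun _ _ h => h.1

namespace IsMeasure

variable {r : ℕ} {ν : ∀ (E : Type w) [Coord M E], Set E → A}

theorem sum_pieces (hν : IsMeasure L C r ν) {X : Set E} (hX : Fiberable L C r X) {T : Type*}
    {ψ : E → T} (hψ : Simple L ψ) (s : Finset T) :
    ν E (X ∩ ψ ⁻¹' s) = ∑ b ∈ s, ν E (X ∩ ψ ⁻¹' {b}) := by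
  classical
  induction s using Finset.induction_on with
  | empty => simp [hν.empty]
  | insert b s hb ih =>
    have hs : DefPred L (· ∈ X ∩ ψ ⁻¹' s) := by
      refine (hX.1.and (DefPred.exists_finset s (p := fun b x => ψ x = b)
        fun b _ => hψ.def_level b)).congr fun x => ?_
      simp
    have hb' := defPred_inter_preimage hX.1 hψ b
    have heq : X ∩ ψ ⁻¹' (insert b s : Finset T) = (X ∩ ψ ⁻¹' {b}) ∪ (X ∩ ψ ⁻¹' s) := by
      rw [← inter_union_distrib_left, ← preimage_union, Finset.coe_insert, insert_eq]
    rw [Finset.sum_insert hb, ← ih, heq]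
    refine hν.union (hX.subset (hb'.or hs) (by simp)) hb' hs ?_
    refine disjoint_left.2 fun x hx hx' => hb ?_
    rw [← show ψ x = b from hx.2]
    exact hx'.2

/-- The integral of `h ∘ ψ` may be computed on the finer partition into level sets of `ψ`. With `ψ`
a pair of simple functions this gives additivity. -/
theorem integ_map (hν : IsMeasure L C r ν) {Y : Set E} (hY : Fiberable L C r Y) {T : Type*}
    {ψ : E → T} (hψ : Simple L ψ) (h : T → A) {s : Finset T} (hs : ∀ x ∈ Y, ψ x ∈ s) :
    integ ν Y (fun x => h (ψ x)) = ∑ b ∈ s, h b * ν E (Y ∩ ψ ⁻¹' {b}) := by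
  classical
  unfold integ
  rw [finsum_eq_sum_of_support_subset (s := s.image h)]
  · rw [← Finset.sum_fiberwise_of_maps_to (t := s.image h) (g := h)
      fun b hb => Finset.mem_image_of_mem h hb]
    refine Finset.sum_congr rfl fun a _ => ?_
    have : Y ∩ (fun x => h (ψ x)) ⁻¹' {a} = Y ∩ ψ ⁻¹' (s.filter fun b => h b = a : Finset T) := by
      ext x
      simp only [mem_inter_iff, mem_preimage, mem_singleton_iff, Finset.coe_filter, mem_ofPred_eq]
      exact ⟨fun hx => ⟨hx.1, hs x hx.1, hx.2⟩, fun hx => ⟨hx.1, hx.2.2⟩⟩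
    rw [this, hν.sum_pieces hY hψ, Finset.mul_sum]
    refine Finset.sum_congr rfl fun b hb => ?_
    rw [(Finset.mem_filter.1 hb).2]
  -- A value not attained on `Y` has an empty level set, so it does not contribute to the `finsum`.
  · intro a ha
    by_contra hna
    refine ha ?_
    have : Y ∩ (fun x => h (ψ x)) ⁻¹' {a} = ∅ := by
      refine eq_empty_of_forall_notMem fun x hx => hna ?_
      rw [← show h (ψ x) = a from hx.2]
      exact Finset.mem_coe.2 (Finset.mem_image_of_mem h (hs x hx.1))
    simp only [this, hν.empty, mul_zero]

theorem integ_eq_sum (hν : IsMeasure L C r ν) {Y : Set E} (hY : Fiberable L C r Y)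
    {φ : E → A} (hφ : Simple L φ) {s : Finset A} (hs : ∀ x ∈ Y, φ x ∈ s) :
    integ ν Y φ = ∑ a ∈ s, a * ν E (Y ∩ φ ⁻¹' {a}) :=
  hν.integ_map hY hφ (fun a => a) hs

theorem integ_add (hν : IsMeasure L C r ν) {Y : Set E} (hY : Fiberable L C r Y)
    {φ ψ : E → A} (hφ : Simple L φ) (hψ : Simple L ψ) :
    integ ν Y (fun x => φ x + ψ x) = integ ν Y φ + integ ν Y ψ := by
  have h := hφ.prodMk hψ
  have hs : ∀ x ∈ Y, (φ x, ψ x) ∈ h.finite.toFinset := fun x _ =>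
    h.finite.mem_toFinset.2 ⟨x, rfl⟩
  rw [hν.integ_map hY h (fun z => z.1 + z.2) hs, hν.integ_map hY h (fun z => z.1) hs,
    hν.integ_map hY h (fun z => z.2) hs, ← Finset.sum_add_distrib]
  simp only [add_mul]

theorem integ_const_mul (hν : IsMeasure L C r ν) {Y : Set E} (hY : Fiberable L C r Y)
    {φ : E → A} (hφ : Simple L φ) (b : A) :
    integ ν Y (fun x => b * φ x) = b * integ ν Y φ := by
  have hs : ∀ x ∈ Y, φ x ∈ hφ.finite.toFinset := by simp
  rw [hν.integ_map hY hφ (fun a => b * a) hs, hν.integ_eq_sum hY hφ hs, Finset.mul_sum]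
  simp only [mul_assoc]

theorem integ_const (hν : IsMeasure L C r ν) {Y : Set E} (hY : Fiberable L C r Y) (b : A) :
    integ ν Y (fun _ => b) = b * ν E Y := by
  rw [hν.integ_map hY (Simple.const ()) (fun _ => b) (s := {()}) (by simp)]
  simp

theorem integ_sum (hν : IsMeasure L C r ν) {Y : Set E} (hY : Fiberable L C r Y) {ι : Type*}
    {φ : ι → E → A} (s : Finset ι) (hφ : ∀ i ∈ s, Simple L (φ i)) :
    integ ν Y (fun x => ∑ i ∈ s, φ i x) = ∑ i ∈ s, integ ν Y (φ i) := by
  classical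
  induction s using Finset.induction_on with
  | empty => simpa using hν.integ_const hY 0
  | insert i s hi ih =>
    have hs : ∀ j ∈ s, Simple L (φ j) := fun j hj => hφ j (by simp [hj])
    simp only [Finset.sum_insert hi]
    rw [hν.integ_add hY (hφ i (by simp)) (.sum s hs), ih hs]

theorem integ_singleton (hν : IsMeasure L C r ν) (hC : C.Nonempty) (x : E) (φ : E → A) :
    integ ν {x} φ = φ x := by
  rw [integ_congr ν (ψ := fun _ => φ x) (by simp), hν.integ_const (.singleton hC r x),
    hν.singleton, mul_one]

theorem simple_integ (hν : IsMeasure L C r ν) {W : Set (P × E)} (hW : DefPred L (· ∈ W))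
    (hU : UF L C r W) {φ : P × E → A} (hφ : Simple L φ) :
    Simple L fun p => integ ν (slice W p) fun x => φ (p, x) := by
  have : ∀ p, integ ν (slice W p) (fun x => φ (p, x)) =
      ∑ a ∈ hφ.finite.toFinset, a * ν E (slice (W ∩ φ ⁻¹' {a}) p) := fun p =>
    hν.integ_eq_sum (.of_family hU (by simp only [mem_slice]; fun_prop) subset_rfl)
      (hφ.comp (by fun_prop)) (by simp)
  simp only [this]
  refine .sum _ fun a _ => ?_
  have hd := defPred_inter_preimage hW hφ a
  exact (hν.simple hd (hU.of_subset hd fun p _ => ⟨p, fun x hx => hx.1⟩)).map fun b => a * b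

/-- The Fubini axiom treats only fibers of constant measure; here `Y` is cut into the finitely many
pieces on which the measure of the fiber is constant. -/
theorem eq_integ_fibers (hν : IsMeasure L C r ν) {X : Set E} (hX : Fiberable L C r X) {Y : Set F}
    (hY : Fiberable L C r Y) {f : E → F} (hf : DefFun L f) (hm : MapsTo f X Y) :
    ν E X = integ ν Y fun y => ν E (X ∩ f ⁻¹' {y}) := by
  have hs : Simple L fun y => ν E (X ∩ f ⁻¹' {y}) :=
    hν.simple (defPred_fiberFam hX.1 hf) (hX.uf_fiberFam hf)
  rw [hν.integ_eq_sum hY hs (s := hs.finite.toFinset) (by simp)]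
  have hs' := hs.comp hf
  have := hν.sum_pieces hX hs' hs.finite.toFinset
  rw [inter_eq_left.2 fun x _ => by simp] at this
  rw [this]
  refine Finset.sum_congr rfl fun a _ => ?_
  have h1 := defPred_inter_preimage hX.1 hs' a
  have h2 := defPred_inter_preimage hY.1 hs a
  refine hν.fubini (hX.subset h1 inter_subset_left) (hY.subset h2 inter_subset_left) hf
    (fun x hx => ⟨hm hx.1, hx.2⟩) fun y hy => ?_
  rw [← show ν E (X ∩ f ⁻¹' {y}) = a from hy.2]
  congr 1
  ext x
  simp only [mem_inter_iff, mem_preimage, mem_singleton_iff]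
  refine ⟨fun h => ⟨h.1.1, h.2⟩, fun h => ⟨⟨h.1, ?_⟩, h.2⟩⟩
  simp [h.2]

/-- `eq_integ_fibers` is applied to each level set of `φ`, and the results are added with their
weights. -/
theorem integ_fibers (hν : IsMeasure L C r ν) {X : Set E} (hX : Fiberable L C r X) {Y : Set F}
    (hY : Fiberable L C r Y) {f : E → F} (hf : DefFun L f) (hm : MapsTo f X Y) {φ : E → A}
    (hφ : Simple L φ) :
    integ ν X φ = integ ν Y fun y => integ ν (X ∩ f ⁻¹' {y}) φ := by
  have hs : ∀ x ∈ X, φ x ∈ hφ.finite.toFinset := by simp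
  have hfd := defPred_fiberFam hX.1 hf
  have key : ∀ y, integ ν (X ∩ f ⁻¹' {y}) φ = ∑ a ∈ hφ.finite.toFinset,
      a * ν E ((X ∩ φ ⁻¹' {a}) ∩ f ⁻¹' {y}) := fun y => by
    rw [hν.integ_eq_sum (s := hφ.finite.toFinset) _ hφ (by simp)]
    · simp only [inter_right_comm]
    · refine hX.subset ?_ inter_subset_left
      exact hX.1.and (DefPred.eq hf (.const y))
  have hXa : ∀ a, Fiberable L C r (X ∩ φ ⁻¹' {a}) := fun a =>
    hX.subset (defPred_inter_preimage hX.1 hφ a) inter_subset_left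
  have hsim : ∀ a, Simple L fun y => ν E ((X ∩ φ ⁻¹' {a}) ∩ f ⁻¹' {y}) := fun a =>
    hν.simple (defPred_fiberFam (hXa a).1 hf) ((hXa a).uf_fiberFam hf)
  simp only [key]
  rw [hν.integ_eq_sum hX hφ hs, hν.integ_sum hY _ fun a _ => (hsim a).map fun b => a * b]
  refine Finset.sum_congr rfl fun a _ => ?_
  rw [hν.integ_const_mul hY (hsim a), ← hν.eq_integ_fibers (hXa a) hY hf fun x hx => hm hx.1]

theorem eq_of_bijOn (hν : IsMeasure L C r ν) {X : Set E} (hX : Fiberable L C r X) {Y : Set F}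
    (hY : Fiberable L C r Y) {f : E → F} (hf : DefFun L f) (hb : BijOn f X Y) :
    ν E X = ν F Y := by
  rw [hν.fubini hX hY hf hb.mapsTo (a := 1), one_mul]
  intro y hy
  obtain ⟨x, hx, rfl⟩ := hb.surjOn hy
  rw [← hν.singleton x]
  congr 1
  ext z
  simp only [mem_inter_iff, mem_preimage, mem_singleton_iff]
  exact ⟨fun h => hb.injOn h.1 hx h.2, by rintro rfl; exact ⟨hx, rfl⟩⟩

theorem integ_of_bijOn (hν : IsMeasure L C r ν) {X : Set E} (hX : Fiberable L C r X) {Y : Set F}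
    (hY : Fiberable L C r Y) {f : E → F} (hf : DefFun L f) (hb : BijOn f X Y) {φ : F → A}
    (hφ : Simple L φ) : integ ν X (fun x => φ (f x)) = integ ν Y φ := by
  unfold integ
  congr! 3 with a
  refine hν.eq_of_bijOn
    (hX.subset (defPred_inter_preimage hX.1 (hφ.comp hf) a) inter_subset_left)
    (hY.subset (defPred_inter_preimage hY.1 hφ a) inter_subset_left) hf
    ⟨fun x hx => ⟨hb.mapsTo hx.1, hx.2⟩, hb.injOn.mono inter_subset_left, ?_⟩
  rintro _ ⟨hy, hy'⟩
  obtain ⟨x, hx, rfl⟩ := hb.surjOn hy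
  exact ⟨x, ⟨hx, hy'⟩, rfl⟩

/-- Both sides are the integral over `X ×ˢ Y`, computed along its two projections. -/
theorem integ_swap (hν : IsMeasure L C r ν) {X : Set E} (hX : Fiberable L C r X) {Y : Set F}
    (hY : Fiberable L C r Y) {φ : E × F → A} (hφ : Simple L φ) :
    (integ ν X fun x => integ ν Y fun y => φ (x, y)) =
      integ ν Y fun y => integ ν X fun x => φ (x, y) := by
  have hXY := hX.prod hY
  have hXY' := hXY.1
  trans integ ν (X ×ˢ Y) φ
  · rw [hν.integ_fibers hXY hX (f := fun z => z.1) (by fun_prop) (fun z hz => hz.1) hφ]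
    refine integ_congr ν fun x hx => ?_
    refine hν.integ_of_bijOn hY (hXY.subset ?_ inter_subset_left) (f := fun y => (x, y))
      (by fun_prop) ⟨fun y hy => ⟨⟨hx, hy⟩, rfl⟩, fun y _ y' _ h => congrArg Prod.snd h, ?_⟩ hφ
    · simp only [mem_inter_iff, mem_preimage, mem_singleton_iff]; fun_prop
    · rintro ⟨x', y⟩ ⟨⟨_, hy⟩, rfl⟩
      exact ⟨y, hy, rfl⟩
  · rw [hν.integ_fibers hXY hY (f := fun z => z.2) (by fun_prop) (fun z hz => hz.2) hφ]
    refine integ_congr ν fun y hy => Eq.symm ?_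
    refine hν.integ_of_bijOn hX (hXY.subset ?_ inter_subset_left) (f := fun x => (x, y))
      (by fun_prop) ⟨fun x hx => ⟨⟨hx, hy⟩, rfl⟩, fun x _ x' _ h => congrArg Prod.fst h, ?_⟩ hφ
    · simp only [mem_inter_iff, mem_preimage, mem_singleton_iff]; fun_prop
    · rintro ⟨x, y'⟩ ⟨⟨hx, _⟩, rfl⟩
      exact ⟨x, hx, rfl⟩

end IsMeasure

end

/-! ### Fibrations and the extension of a measure by one step. -/

section

variable {L : FirstOrder.Language.{u, v}} {M : Type w} [L.Structure M] {C : Set M}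
variable {P Q E F G : Type w} [Coord M P] [Coord M Q] [Coord M E] [Coord M F] [Coord M G]
variable {A : Type t} [CommSemiring A]

variable (L C) in
/-- `f` fibers `X` over the `r`-fiberable set `Y` with uniformly `r`-fiberable fibers. -/
structure IsFibration (r : ℕ) (X : Set E) (f : E → F) (Y : Set F) : Prop where
  defPred : DefPred L (· ∈ X)
  base : Fiberable L C r Y
  defFun : DefFun L f
  mapsTo : MapsTo f X Y
  fibers : UF L C r (fiberFam X f)

namespace IsFibration

variable {r : ℕ} {X : Set E} {f : E → F} {Y : Set F}

theorem mono (h : IsFibration L C r X f Y) {X' : Set E} (hX' : DefPred L (· ∈ X'))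
    (hXX : X' ⊆ X) : IsFibration L C r X' f Y :=
  ⟨hX', h.base, h.defFun, h.mapsTo.mono_left hXX,
    h.fibers.of_subset (defPred_fiberFam hX' h.defFun) fun y _ => ⟨y, fun _ hx => ⟨hXX hx.1, hx.2⟩⟩⟩

theorem defPred_fiber (h : IsFibration L C r X f Y) (y : F) : DefPred L (· ∈ X ∩ f ⁻¹' {y}) :=
  h.defPred.and (DefPred.eq h.defFun (.const y))

theorem fiberable (h : IsFibration L C r X f Y) (y : F) : Fiberable L C r (X ∩ f ⁻¹' {y}) :=
  .of_family h.fibers (h.defPred_fiber y) (p := y) subset_rfl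

theorem prodMk (h : IsFibration L C r X f Y) {g : E → G} (hg : DefFun L g) :
    UF L C r (fiberFam X fun x => (f x, g x)) :=
  h.fibers.of_subset (defPred_fiberFam h.defPred (h.defFun.prodMk hg))
    fun y _ => ⟨y.1, fun _ hx => ⟨hx.1, congrArg Prod.fst hx.2⟩⟩

variable {ν : ∀ (E : Type w) [Coord M E], Set E → A}

theorem simple (h : IsFibration L C r X f Y) (hν : IsMeasure L C r ν) :
    Simple L fun y => ν E (X ∩ f ⁻¹' {y}) :=
  hν.simple (defPred_fiberFam h.defPred h.defFun) h.fibers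

theorem simple_prodMk (h : IsFibration L C r X f Y) (hν : IsMeasure L C r ν) {g : E → G}
    (hg : DefFun L g) :
    Simple L fun z : F × G => ν E ((X ∩ f ⁻¹' {z.1}) ∩ g ⁻¹' {z.2}) := by
  have := hν.simple (defPred_fiberFam h.defPred (h.defFun.prodMk hg)) (h.prodMk hg)
  convert this using 3 with z
  ext x
  simp only [slice, fiberFam, mem_inter_iff, mem_preimage, mem_singleton_iff, mem_ofPred_eq,
    Prod.ext_iff, and_assoc]

/-- Each fiber of `f` is `r`-fiberable, so its measure is an integral over `Z`; then the order is
swapped. Nothing is asked of the fibers of `g`, which need not be `r`-fiberable. -/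
theorem integ_fiber (h : IsFibration L C r X f Y) (hν : IsMeasure L C r ν) {g : E → G}
    {Z : Set G} (hg : DefFun L g) (hZ : Fiberable L C r Z) (hm : MapsTo g X Z) :
    integ ν Y (fun y => ν E (X ∩ f ⁻¹' {y})) =
      integ ν Z fun z => integ ν Y fun y => ν E ((X ∩ f ⁻¹' {y}) ∩ g ⁻¹' {z}) := by
  rw [← hν.integ_swap h.base hZ (h.simple_prodMk hν hg)]
  exact integ_congr ν fun y _ => hν.eq_integ_fibers (h.fiberable y) hZ hg fun x hx => hm hx.1

/-- If the fibers of `g` are `r`-fiberable too, the inner integral collapses. This makes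
`stepMeasure` independent of the fibration. -/
theorem integ_eq (h : IsFibration L C r X f Y) (hν : IsMeasure L C r ν) {g : E → G}
    {Z : Set G} (h' : IsFibration L C r X g Z) :
    integ ν Y (fun y => ν E (X ∩ f ⁻¹' {y})) = integ ν Z fun z => ν E (X ∩ g ⁻¹' {z}) := by
  rw [h.integ_fiber hν h'.defFun h'.base h'.mapsTo]
  refine integ_congr ν fun z _ => ?_
  rw [hν.eq_integ_fibers (h'.fiberable z) h.base h.defFun fun x hx => h.mapsTo hx.1]
  simp only [inter_right_comm]

end IsFibration

theorem Fiberable.exists_fibration {r : ℕ} {X : Set E} (hX : Fiberable L C (r + 1) X) :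
    ∃ (F : Type w) (_ : Coord M F) (f : E → F) (Y : Set F), IsFibration L C r X f Y := by
  have hXd := hX.1
  -- `UF` promises an index only for nonempty members.
  rcases X.eq_empty_or_nonempty with rfl | hne
  · exact ⟨E, inferInstance, fun x => x, ∅, hXd, .of_empty r, by fun_prop, fun x hx => hx,
      .of_empty r fun p => by simp [slice, fiberFam]⟩
  · obtain ⟨Q, _, F, _, f, D, hf, hD, H, hfib, hran⟩ := hX.2
    obtain ⟨q, hq⟩ := H Fin.elim0 hne
    have hq : ∀ x, (q, x) ∈ D ↔ x ∈ X := fun x => Set.ext_iff.1 hq x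
    have hr := hf.defPred_ranges hD
    have hfq : DefFun L fun x => f (q, x) := by fun_prop
    refine ⟨F, inferInstance, fun x => f (q, x), slice (ranges f D) q, hXd,
      .of_family hran (by simp only [mem_slice]; fun_prop) subset_rfl, hfq,
      fun x hx => ⟨x, (hq x).2 hx, rfl⟩, ?_⟩
    exact hfib.of_subset (defPred_fiberFam hXd hfq) fun y _ =>
      ⟨(q, y), fun x hx => ⟨(hq x).2 hx.1, hx.2⟩⟩

/-- The fibration over a point shows that `stepMeasure` extends the measure it starts from. -/
theorem Fiberable.isFibration {r : ℕ} {X : Set E} (hX : Fiberable L C r X) (hC : C.Nonempty) :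
    IsFibration L C r X (fun _ => (Fin.elim0 : Fin 0 → M)) {Fin.elim0} :=
  ⟨hX.1, .singleton hC r _, by fun_prop, fun _ _ => rfl, hX.uf_fiberFam (by fun_prop)⟩

open Classical in
variable (L C) in
/-- The extension of a measure from the `r`-fiberable sets to the `(r + 1)`-fiberable sets. -/
noncomputable def stepMeasure (r : ℕ) (ν : ∀ (E : Type w) [Coord M E], Set E → A) :
    ∀ (E : Type w) [Coord M E], Set E → A := fun E _ X =>
  if h : ∃ (a : A) (F : Type w) (_ : Coord M F) (f : E → F) (Y : Set F),
    IsFibration L C r X f Y ∧ (integ ν Y fun y => ν E (X ∩ f ⁻¹' {y})) = a then h.choose else 0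

namespace IsMeasure

variable {r : ℕ} {ν : ∀ (E : Type w) [Coord M E], Set E → A}

theorem stepMeasure_eq (hν : IsMeasure L C r ν) {X : Set E} {f : E → F} {Y : Set F}
    (h : IsFibration L C r X f Y) :
    stepMeasure L C r ν E X = integ ν Y fun y => ν E (X ∩ f ⁻¹' {y}) := by
  have hex : ∃ (a : A) (F : Type w) (_ : Coord M F) (f : E → F) (Y : Set F),
      IsFibration L C r X f Y ∧ (integ ν Y fun y => ν E (X ∩ f ⁻¹' {y})) = a :=
    ⟨_, F, inferInstance, f, Y, h, rfl⟩
  unfold stepMeasure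
  rw [dif_pos hex]
  obtain ⟨F', _, f', Y', h', ha⟩ := hex.choose_spec
  rw [← ha]
  exact h'.integ_eq hν h

theorem stepMeasure_of_fiberable (hν : IsMeasure L C r ν) (hC : C.Nonempty) {X : Set E}
    (hX : Fiberable L C r X) : stepMeasure L C r ν E X = ν E X := by
  rw [hν.stepMeasure_eq (hX.isFibration hC), hν.integ_singleton hC]
  congr 1
  ext x
  simp

theorem stepMeasure_simple (hν : IsMeasure L C r ν) (hC : C.Nonempty) {S : Set (P × E)}
    (hS : DefPred L (· ∈ S)) (hU : UF L C (r + 1) S) :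
    Simple L fun p => stepMeasure L C r ν E (slice S p) := by
  have hempty : stepMeasure L C r ν E ∅ = 0 := by
    rw [hν.stepMeasure_of_fiberable hC (.of_empty r), hν.empty]
  obtain ⟨Q, _, F, _, f, D, hf, hD, H, hfib, hran⟩ := hU
  have hr := hf.defPred_ranges hD
  have hψ := hν.simple_integ hr hran (hν.simple (hf.defPred_fibers hD) hfib)
  set ψ := fun q => integ ν (slice (ranges f D) q) fun y => ν E (slice (fibers f D) (q, y))
    with hψd
  have key : ∀ q, stepMeasure L C r ν E (slice D q) = ψ q := fun q => by
    have hfq : DefFun L fun x => f (q, x) := by fun_prop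
    have hDq : DefPred L (· ∈ slice D q) := by simp only [mem_slice]; fun_prop
    have : IsFibration L C r (slice D q) (fun x => f (q, x)) (slice (ranges f D) q) :=
      ⟨hDq, .of_family hran (by simp only [mem_slice]; fun_prop) subset_rfl, hfq,
        fun x hx => ⟨x, hx, rfl⟩, hfib.of_subset (defPred_fiberFam hDq hfq) fun y _ =>
        ⟨(q, y), fun x hx => hx⟩⟩
    rw [hν.stepMeasure_eq this]
    rfl
  refine ⟨(hψ.finite.insert 0).subset ?_, fun a => ?_⟩
  · rintro _ ⟨p, rfl⟩
    rcases (slice S p).eq_empty_or_nonempty with hp | hp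
    · left
      simp only [hp, hempty]
    · obtain ⟨q, hq⟩ := H p hp
      right
      exact ⟨q, by rw [← key, hq]⟩
  · have h1 := DefPred.slice_eq hD hS
    have h2 := hψ.def_level a
    -- The index `q` is not a function of `p`, so it is quantified away; by `key` the value `ψ q`
    -- depends only on `slice D q`. Empty slices may have no index and are treated apart.
    have h3 : DefPred L fun p => ((¬ ∃ x, (p, x) ∈ S) ∧ 0 = a) ∨ ((∃ x, (p, x) ∈ S) ∧
        ∃ q, slice D (q, p).1 = slice S (q, p).2 ∧ ψ q = a) := by
      refine .or (by fun_prop) (.and (by fun_prop) (.ex (.and ?_ ?_)))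
      · exact h1.comp (f := fun z : P × Q => (z.2, z.1)) (by fun_prop)
      · exact h2.comp (f := fun z : P × Q => z.2) (by fun_prop)
    refine h3.congr fun p => ?_
    by_cases hp : ∃ x, (p, x) ∈ S
    · simp only [hp, not_true, false_and, false_or, true_and]
      constructor
      · rintro ⟨q, hq, rfl⟩
        rw [← key, hq]
      · rintro rfl
        obtain ⟨q, hq⟩ := H p (by obtain ⟨x, hx⟩ := hp; exact ⟨x, hx⟩)
        exact ⟨q, hq, by rw [← key, hq]⟩
    · have : slice S p = ∅ := eq_empty_of_forall_notMem fun x hx => hp ⟨x, hx⟩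
      simp only [hp, this, hempty, not_false_iff, true_and, false_and, or_false]

/-- The fibers of `h` are only `(r + 1)`-fiberable, so `ν` need not measure them. With fibrations `k
: X → V` and `l : Y → Z`, the integral over `V` is first spread over `Z` along `l ∘ h`, then over
each `r`-fiberable fiber of `l`. -/
theorem stepMeasure_fubini (hν : IsMeasure L C r ν) {X : Set E} {Y : Set F} {h : E → F} {a : A}
    (hX : Fiberable L C (r + 1) X) (hY : Fiberable L C (r + 1) Y) (hh : DefFun L h)
    (hm : MapsTo h X Y) (ha : ∀ y ∈ Y, stepMeasure L C r ν E (X ∩ h ⁻¹' {y}) = a) :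
    stepMeasure L C r ν E X = a * stepMeasure L C r ν F Y := by
  obtain ⟨G, _, k, V, hk⟩ := hX.exists_fibration
  obtain ⟨H, _, l, Z, hl⟩ := hY.exists_fibration
  have hl' := hl.defFun
  rw [hν.stepMeasure_eq hk, hν.stepMeasure_eq hl,
    hk.integ_fiber hν (g := fun x => l (h x)) (by fun_prop) hl.base (hl.mapsTo.comp hm),
    ← hν.integ_const_mul hl.base (hl.simple hν)]
  refine integ_congr ν fun z _ => ?_
  have hYz := hl.fiberable z
  have hXz : DefPred L (· ∈ X ∩ (fun x => l (h x)) ⁻¹' {z}) :=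
    hX.1.and (DefPred.eq (by fun_prop) (.const z))
  have hkz := hk.mono hXz inter_subset_left
  have hmz : MapsTo h (X ∩ (fun x => l (h x)) ⁻¹' {z}) (Y ∩ l ⁻¹' {z}) :=
    fun x hx => ⟨hm hx.1, hx.2⟩
  have hcomm : ∀ v, (X ∩ k ⁻¹' {v}) ∩ (fun x => l (h x)) ⁻¹' {z} =
      (X ∩ (fun x => l (h x)) ⁻¹' {z}) ∩ k ⁻¹' {v} := fun v => inter_right_comm _ _ _
  simp only [hcomm]
  -- Over a fixed `z` the base of `h` is `r`-fiberable. After the swap, the inner integral over `V`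
  -- is the step measure of a fiber of `h`, that is, `a`.
  rw [hkz.integ_fiber hν hh hYz hmz, ← hν.integ_const hYz]
  refine integ_congr ν fun y hy => ?_
  have hXy : DefPred L (· ∈ X ∩ h ⁻¹' {y}) := hX.1.and (DefPred.eq hh (.const y))
  rw [← ha y hy.1, hν.stepMeasure_eq (hk.mono hXy inter_subset_left)]
  refine integ_congr ν fun v _ => ?_
  congr 1
  ext x
  simp only [mem_inter_iff, mem_preimage, mem_singleton_iff]
  refine ⟨fun hx => ⟨⟨hx.1.1.1, hx.2⟩, hx.1.2⟩, fun hx => ⟨⟨⟨hx.1.1, ?_⟩, hx.2⟩, hx.1.2⟩⟩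
  rw [hx.1.2]
  exact hy.2

theorem step (hν : IsMeasure L C r ν) (hC : C.Nonempty) :
    IsMeasure L C (r + 1) (stepMeasure L C r ν) where
  simple := hν.stepMeasure_simple hC
  empty E _ := by rw [hν.stepMeasure_of_fiberable hC (.of_empty r), hν.empty]
  singleton x := by rw [hν.stepMeasure_of_fiberable hC (.singleton hC r x), hν.singleton]
  union {E _ X Y} hXY hX hY hd := by
    -- One fibration of the union restricts to both parts, so the claim reduces to additivity of `ν`
    -- on the fibers.
    obtain ⟨F, _, f, Z, hf⟩ := hXY.exists_fibration
    have hfX := hf.mono hX subset_union_left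
    have hfY := hf.mono hY subset_union_right
    rw [hν.stepMeasure_eq hf, hν.stepMeasure_eq hfX, hν.stepMeasure_eq hfY,
      ← hν.integ_add hf.base (hfX.simple hν) (hfY.simple hν)]
    refine integ_congr ν fun z _ => ?_
    have := hf.fiberable z
    rw [union_inter_distrib_right] at this ⊢
    exact hν.union this (hfX.defPred_fiber z) (hfY.defPred_fiber z)
      (hd.mono inter_subset_left inter_subset_left)
  fubini := hν.stepMeasure_fubini

end IsMeasure

end

/-! ### Definable graphs, stable embeddedness with parameters, and Fubini measures as functions on
sets. -/

section

variable {L : FirstOrder.Language.{u, v}} {M : Type w} [L.Structure M] {C : Set M}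
variable {P Q E F G : Type w} [Coord M P] [Coord M Q] [Coord M E] [Coord M F] [Coord M G]

/-- A definable partial map becomes total by taking the value `y₀` off its domain. -/
theorem exists_defFun_of_graph {R : Set (E × F)} (hR : DefPred L (· ∈ R))
    (hfun : ∀ x y y', (x, y) ∈ R → (x, y') ∈ R → y = y') (y₀ : F) :
    ∃ f : E → F, DefFun L f ∧ ∀ x y, (x, y) ∈ R → f x = y := by
  classical
  have hf : ∀ x y, (x, y) ∈ R → (if h : ∃ y, (x, y) ∈ R then h.choose else y₀) = y := by
    intro x y hxy
    have h : ∃ y, (x, y) ∈ R := ⟨y, hxy⟩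
    rw [dif_pos h]
    exact hfun x _ _ h.choose_spec hxy
  refine ⟨fun x => if h : ∃ y, (x, y) ∈ R then h.choose else y₀, ?_, hf⟩
  have : DefPred L fun z : E × F => z ∈ R ∨ (¬ ∃ y, (z.1, y) ∈ R) ∧ y₀ = z.2 := by fun_prop
  refine this.congr fun z => ?_
  constructor
  · rintro (hz | ⟨hz, h⟩)
    · exact hf z.1 z.2 hz
    · simpa [hz] using h
  · intro hz
    by_cases h : ∃ y, (z.1, y) ∈ R
    · obtain ⟨y, hy⟩ := h
      have : z = (z.1, y) := Prod.ext rfl (hz.symm.trans (hf _ _ hy))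
      exact .inl (this ▸ hy)
    · exact .inr ⟨h, by simpa [h] using hz⟩

/-- Stable embeddedness concerns 0-definable families. The finitely many parameters in a definition
of `R` are joined to the index `q`, which makes the family 0-definable. -/
theorem StablyEmbedded.exists_family (hst : StablyEmbedded L C) {n : ℕ}
    {R : Set (Q × (Fin n → M))} (hR : DefPred L (· ∈ R)) :
    ∃ (k : ℕ) (T : Set ((Fin k → M) × (Fin n → M))), DefPred L (· ∈ T) ∧
      ∀ q, ∃ c : Fin k → M, (∀ i, c i ∈ C) ∧
        ∀ y : Fin n → M, (∀ j, y j ∈ C) → ((q, y) ∈ R ↔ (c, y) ∈ T) := by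
  classical
  obtain ⟨A₀, -, hA₀⟩ := definable_iff_finitely_definable.1 hR
  obtain ⟨φ, hφ⟩ := definable_iff_exists_formula_sum.1 hA₀
  obtain ⟨m, ⟨σ⟩⟩ := Finite.exists_equiv_fin ((A₀ : Set M) ⊕ Coord.ι Q)
  have hΦ : (∅ : Set M).Definable L {v | φ.Realize v} := empty_definable_iff.2 ⟨φ, rfl⟩
  let τ : (A₀ : Set M) ⊕ (Coord.ι Q ⊕ Fin n) → Fin m ⊕ Fin n :=
    Sum.elim (fun a => .inl (σ (.inl a))) (Sum.elim (fun i => .inl (σ (.inr i))) .inr)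
  obtain ⟨k, T, hT, H⟩ := hst m n _ (hΦ.preimage_comp τ)
  refine ⟨k, {z | Sum.elim z.1 z.2 ∈ T}, defPred_sumElim_iff.2 (hT.mono (empty_subset _)),
    fun q => ?_⟩
  obtain ⟨c, hc, h⟩ := H (Sum.elim (fun a : (A₀ : Set M) => (a : M)) (Coord.e q) ∘ σ.symm)
  refine ⟨c, hc, fun y hy => ?_⟩
  refine Iff.trans ?_ (h y hy)
  have := Set.ext_iff.1 hφ (Coord.e (q, y))
  simp only [mem_ofPred_eq, Equiv.symm_apply_apply] at this
  rw [this]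
  refine Iff.trans (iff_of_eq (congrArg φ.Realize ?_)) Iff.rfl
  funext a
  rcases a with a | i | j
  · simp [τ]
  · simp only [Sum.elim_inr, Function.comp_apply, Sum.elim_inl, Equiv.symm_apply_apply, τ]
    rfl
  · rfl

section

variable {A : Type t} {𝒞 : ObjClass L M}

/-- The set `S` is an object of `𝒞`. -/
def InClass (𝒞 : ObjClass L M) {m : ℕ} (S : Set (Fin m → M)) : Prop :=
  ∃ F : 𝒞 m, ((F : DefSet L M m) : Set (Fin m → M)) = S

open Classical in
/-- The value of a measure, as a function on all sets. -/
noncomputable def val [Zero A] (μ : ∀ m, 𝒞 m → A) {m : ℕ} (S : Set (Fin m → M)) : A :=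
  if h : InClass 𝒞 S then μ m h.choose else 0

theorem InClass.defPred {m : ℕ} {S : Set (Fin m → M)} (h : InClass 𝒞 S) : DefPred L (· ∈ S) := by
  obtain ⟨F, rfl⟩ := h
  exact F.1.2

variable [CommSemiring A] {μ : ∀ m, 𝒞 m → A}

theorem val_coe (μ : ∀ m, 𝒞 m → A) {m : ℕ} (X : 𝒞 m) :
    val μ ((X : DefSet L M m) : Set (Fin m → M)) = μ m X := by
  have h : InClass 𝒞 ((X : DefSet L M m) : Set (Fin m → M)) := ⟨X, rfl⟩
  unfold val
  rw [dif_pos h]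
  exact congrArg _ (Subtype.ext (SetLike.coe_injective h.choose_spec))

theorem hasValue_iff {m : ℕ} {S : Set (Fin m → M)} {a : A} :
    HasValue μ S a ↔ InClass 𝒞 S ∧ val μ S = a := by
  constructor
  · rintro ⟨F, rfl, rfl⟩
    exact ⟨⟨F, rfl⟩, val_coe μ F⟩
  · rintro ⟨⟨F, rfl⟩, rfl⟩
    exact ⟨F, rfl, (val_coe μ F).symm⟩

/-- The map between definable sets given by a definable map of tuples. -/
def restrictMap {m n : ℕ} {X : DefSet L M m} {Y : DefSet L M n} (f : (Fin m → M) → (Fin n → M))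
    (h : MapsTo f X Y) : X → Y := fun x => ⟨f x, h x.2⟩

theorem isDefMap_restrictMap {m n : ℕ} {X : DefSet L M m} {Y : DefSet L M n}
    {f : (Fin m → M) → (Fin n → M)} (hf : DefFun L f) (h : MapsTo f X Y) :
    IsDefMap (restrictMap f h) := by
  have hX : DefPred L (· ∈ (X : Set (Fin m → M))) := X.2
  refine defPred_sumElim_iff.1 ?_
  have : DefPred L fun z : (Fin m → M) × (Fin n → M) =>
    z.1 ∈ (X : Set (Fin m → M)) ∧ f z.1 = z.2 := by fun_prop
  refine this.congr fun z => ?_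
  simp only [mem_ofPred_eq, Sum.elim_eq_iff, Subtype.exists, restrictMap]
  constructor
  · rintro ⟨h1, h2⟩
    exact ⟨z.1, h1, rfl, h2.symm⟩
  · rintro ⟨x, h1, rfl, h2⟩
    exact ⟨h1, h2.symm⟩

theorem fiber_restrictMap {m n : ℕ} {X : DefSet L M m} {Y : DefSet L M n}
    {f : (Fin m → M) → (Fin n → M)} (h : MapsTo f X Y) (y : Y) :
    fiber (restrictMap f h) y = (X : Set (Fin m → M)) ∩ f ⁻¹' {(y : Fin n → M)} := by
  ext v
  simp only [fiber, restrictMap, Subtype.exists, mem_ofPred_eq, mem_inter_iff, mem_preimage,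
    mem_singleton_iff, Subtype.ext_iff]
  constructor
  · rintro ⟨x, h1, h2, rfl⟩
    exact ⟨h1, h2⟩
  · rintro ⟨h1, h2⟩
    exact ⟨v, h1, h2, rfl⟩

theorem exists_eq_restrictMap {m n : ℕ} {X : DefSet L M m} {Y : DefSet L M n} {f : X → Y}
    (hf : IsDefMap f) (y₀ : Fin n → M) :
    ∃ (g : (Fin m → M) → (Fin n → M)) (h : MapsTo g X Y), DefFun L g ∧ f = restrictMap g h := by
  obtain ⟨g, hg, H⟩ := exists_defFun_of_graph (defPred_sumElim_iff.2 hf) (y₀ := y₀) (by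
    rintro x y y' ⟨x₁, h₁⟩ ⟨x₂, h₂⟩
    simp only [Sum.elim_eq_iff] at h₁ h₂
    obtain rfl : x₁ = x₂ := Subtype.ext (h₁.1.symm.trans h₂.1)
    rw [h₁.2, h₂.2])
  have h : ∀ x : X, g x = f x := fun x => H _ _ ⟨x, rfl⟩
  refine ⟨g, fun x hx => ?_, hg, ?_⟩
  · rw [h ⟨x, hx⟩]
    exact (f ⟨x, hx⟩).2
  · funext x
    exact Subtype.ext (h x).symm

/-- Closure of a class of definable sets under definable subsets. -/
def IsLower (𝒞 : ObjClass L M) : Prop :=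
  ∀ {m : ℕ} (X Y : DefSet L M m), X ∈ 𝒞 m → Y ≤ X → Y ∈ 𝒞 m

theorem InClass.subset (h𝒞 : IsLower 𝒞) {m : ℕ} {X Y : Set (Fin m → M)} (hX : InClass 𝒞 X)
    (hY : DefPred L (· ∈ Y)) (h : Y ⊆ X) : InClass 𝒞 Y := by
  obtain ⟨F, rfl⟩ := hX
  exact ⟨⟨⟨Y, hY⟩, h𝒞 F.1 _ F.2 h⟩, rfl⟩

namespace IsFubiniMeasure

theorem val_empty (hμ : IsFubiniMeasure 𝒞 μ) (m : ℕ) : val μ (∅ : Set (Fin m → M)) = 0 := by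
  by_cases h : InClass 𝒞 (∅ : Set (Fin m → M))
  · obtain ⟨F, hF⟩ := h
    rw [← hF, val_coe, hμ.empty F hF]
  · simp [val, h]

theorem val_singleton (hμ : IsFubiniMeasure 𝒞 μ) {m : ℕ} {v : Fin m → M}
    (h : InClass 𝒞 ({v} : Set (Fin m → M))) : val μ ({v} : Set (Fin m → M)) = 1 := by
  obtain ⟨F, hF⟩ := h
  rw [← hF, val_coe, hμ.singleton F v hF]

theorem val_union (hμ : IsFubiniMeasure 𝒞 μ) (h𝒞 : IsLower 𝒞) {m : ℕ} {X Y : Set (Fin m → M)}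
    (hX : DefPred L (· ∈ X)) (hY : DefPred L (· ∈ Y)) (hXY : InClass 𝒞 (X ∪ Y))
    (h : Disjoint X Y) : val μ (X ∪ Y) = val μ X + val μ Y := by
  obtain ⟨FX, rfl⟩ := hXY.subset h𝒞 hX subset_union_left
  obtain ⟨FY, rfl⟩ := hXY.subset h𝒞 hY subset_union_right
  obtain ⟨F, hF⟩ := hXY
  rw [← hF, val_coe, val_coe, val_coe]
  refine hμ.union FX FY F ?_ (SetLike.coe_injective hF)
  rw [disjoint_iff_inf_le]
  exact fun x hx => disjoint_left.1 h hx.1 hx.2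

variable {m n : ℕ} {X : Set (Fin m → M)} {Y : Set (Fin n → M)} {f : (Fin m → M) → (Fin n → M)}

theorem inClass_fiber (h𝒞 : IsLower 𝒞) (hX : InClass 𝒞 X) (hf : DefFun L f) (y : Fin n → M) :
    InClass 𝒞 (X ∩ f ⁻¹' {y}) :=
  hX.subset h𝒞 (hX.defPred.and (DefPred.eq hf (.const y))) inter_subset_left

theorem val_finite (hμ : IsFubiniMeasure 𝒞 μ) (h𝒞 : IsLower 𝒞) (hX : InClass 𝒞 X)
    (hY : InClass 𝒞 Y) (hf : DefFun L f) (h : MapsTo f X Y) :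
    ((fun y => val μ (X ∩ f ⁻¹' {y})) '' Y).Finite := by
  have hXf := inClass_fiber h𝒞 hX hf
  obtain ⟨FX, rfl⟩ := hX
  obtain ⟨FY, rfl⟩ := hY
  refine (hμ.finite_values FX FY _ (isDefMap_restrictMap hf h)).subset ?_
  rintro _ ⟨y, hy, rfl⟩
  exact ⟨⟨y, hy⟩, hasValue_iff.2 (by rw [fiber_restrictMap]; exact ⟨hXf y, rfl⟩)⟩

theorem val_definable (hμ : IsFubiniMeasure 𝒞 μ) (h𝒞 : IsLower 𝒞) (hX : InClass 𝒞 X)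
    (hY : InClass 𝒞 Y) (hf : DefFun L f) (h : MapsTo f X Y) (a : A) :
    DefPred L fun y => y ∈ Y ∧ val μ (X ∩ f ⁻¹' {y}) = a := by
  have hXf := inClass_fiber h𝒞 hX hf
  obtain ⟨FX, rfl⟩ := hX
  obtain ⟨FY, rfl⟩ := hY
  refine DefPred.congr (defPred_mem_iff.2 (hμ.definable_values FX FY _ (isDefMap_restrictMap hf h) a))
    fun y => ?_
  simp only [hasValue_iff, fiber_restrictMap, mem_ofPred_eq, Subtype.exists]
  constructor
  · rintro ⟨y, hy, rfl, -, ha⟩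
    exact ⟨hy, ha⟩
  · rintro ⟨hy, ha⟩
    exact ⟨y, hy, rfl, hXf y, ha⟩

theorem val_fubini (hμ : IsFubiniMeasure 𝒞 μ) (h𝒞 : IsLower 𝒞) (hX : InClass 𝒞 X)
    (hY : InClass 𝒞 Y) (hf : DefFun L f) (h : MapsTo f X Y) {a : A}
    (ha : ∀ y ∈ Y, val μ (X ∩ f ⁻¹' {y}) = a) : val μ X = a * val μ Y := by
  have hXf := inClass_fiber h𝒞 hX hf
  obtain ⟨FX, rfl⟩ := hX
  obtain ⟨FY, rfl⟩ := hY
  rw [val_coe, val_coe]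
  refine hμ.fubini FX FY _ (isDefMap_restrictMap hf h) a fun y => hasValue_iff.2 ?_
  rw [fiber_restrictMap]
  exact ⟨hXf _, ha y y.2⟩

end IsFubiniMeasure

end

end

/-! ### Level 0: sets that embed in a power of `C`. -/

section

variable {L : FirstOrder.Language.{u, v}} {M : Type w} [L.Structure M] {C : Set M}
variable {P Q E F G : Type w} [Coord M P] [Coord M Q] [Coord M E] [Coord M F] [Coord M G]
variable {A : Type t} [CommSemiring A]

theorem isLower_defOver : IsLower (DefOver L C) := fun _ _ hX h v hv i => hX v (h hv) i

theorem inClass_defOver_iff {n : ℕ} {S : Set (Fin n → M)} :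
    InClass (DefOver L C) S ↔ DefPred L (· ∈ S) ∧ ∀ v ∈ S, ∀ i, v i ∈ C := by
  constructor
  · rintro ⟨F, rfl⟩
    exact ⟨F.1.2, F.2⟩
  · rintro ⟨h, h'⟩
    exact ⟨⟨⟨S, h⟩, h'⟩, rfl⟩

variable (L C) in
/-- The map `g` embeds `X` into a power of `C`. -/
structure IsEmb (X : Set E) {n : ℕ} (g : E → (Fin n → M)) : Prop where
  defFun : DefFun L g
  injOn : InjOn g X
  mem : ∀ x ∈ X, ∀ i, g x i ∈ C

theorem IsEmb.mono {X Y : Set E} {n : ℕ} {g : E → (Fin n → M)} (h : IsEmb L C X g) (hY : Y ⊆ X) :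
    IsEmb L C Y g :=
  ⟨h.defFun, h.injOn.mono hY, fun x hx => h.mem x (hY hx)⟩

theorem DefPred.image {X : Set E} (hX : DefPred L (· ∈ X)) {g : E → F} (hg : DefFun L g) :
    DefPred L (· ∈ g '' X) := by
  simp only [mem_image]
  fun_prop

theorem IsEmb.inClass {X : Set E} (hX : DefPred L (· ∈ X)) {n : ℕ} {g : E → (Fin n → M)}
    (h : IsEmb L C X g) : InClass (DefOver L C) (g '' X) :=
  inClass_defOver_iff.2 ⟨hX.image h.defFun, by rintro _ ⟨x, hx, rfl⟩; exact h.mem x hx⟩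

variable {μ : ∀ m, DefOver L C m → A}

/-- The map `f` is transported to a map `k` between the images, with `k ∘ g = h ∘ f` on `X`, so that
(F3) for `μ` applies. -/
theorem IsFubiniMeasure.val_image_fubini (hμ : IsFubiniMeasure (DefOver L C) μ)
    (hC : C.Nonempty) {X : Set E} {Y : Set F} (hX : DefPred L (· ∈ X)) (hY : DefPred L (· ∈ Y))
    {f : E → F} (hf : DefFun L f) (hm : MapsTo f X Y) {m n : ℕ} {g : E → (Fin m → M)}
    (hg : IsEmb L C X g) {h : F → (Fin n → M)} (hh : IsEmb L C Y h) {a : A}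
    (ha : ∀ y ∈ Y, val μ (g '' (X ∩ f ⁻¹' {y})) = a) :
    val μ (g '' X) = a * val μ (h '' Y) := by
  have hgd := hg.defFun
  have hhd := hh.defFun
  have hR : DefPred L fun z : (Fin m → M) × (Fin n → M) =>
    ∃ x, x ∈ X ∧ g x = z.1 ∧ h (f x) = z.2 := by fun_prop
  obtain ⟨k, hk, H⟩ := exists_defFun_of_graph (R := {z | ∃ x, x ∈ X ∧ g x = z.1 ∧ h (f x) = z.2})
    hR (by
      rintro _ _ _ ⟨x, hx, rfl, rfl⟩ ⟨x', hx', h1, rfl⟩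
      obtain rfl := hg.injOn hx hx' h1.symm
      rfl) (fun _ => hC.some)
  have H : ∀ x ∈ X, k (g x) = h (f x) := fun x hx => H _ _ ⟨x, hx, rfl, rfl⟩
  refine hμ.val_fubini isLower_defOver (hg.inClass hX) (hh.inClass hY) hk ?_ ?_
  · rintro _ ⟨x, hx, rfl⟩
    rw [H x hx]
    exact mem_image_of_mem h (hm hx)
  · rintro _ ⟨y, hy, rfl⟩
    rw [← ha y hy]
    congr 1
    ext z
    constructor
    · rintro ⟨⟨x, hx, rfl⟩, hz⟩
      refine ⟨x, ⟨hx, hh.injOn (hm hx) hy ?_⟩, rfl⟩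
      rw [← H x hx]
      exact hz
    · rintro ⟨x, ⟨hx, rfl⟩, rfl⟩
      exact ⟨⟨x, hx, rfl⟩, H x hx⟩

theorem IsFubiniMeasure.val_image_singleton (hμ : IsFubiniMeasure (DefOver L C) μ)
    {x : E} {n : ℕ} {g : E → (Fin n → M)} (hg : IsEmb L C {x} g) : val μ (g '' {x}) = 1 := by
  rw [image_singleton, hμ.val_singleton]
  rw [← image_singleton]
  exact hg.inClass (by simp only [mem_singleton_iff]; fun_prop)

theorem IsFubiniMeasure.val_image_eq (hμ : IsFubiniMeasure (DefOver L C) μ)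
    (hC : C.Nonempty) {X : Set E} (hX : DefPred L (· ∈ X)) {m n : ℕ} {g : E → (Fin m → M)}
    (hg : IsEmb L C X g) {h : E → (Fin n → M)} (hh : IsEmb L C X h) :
    val μ (g '' X) = val μ (h '' X) := by
  rw [hμ.val_image_fubini hC hX hX (f := fun x => x) (by fun_prop) (fun x hx => hx) hg hh (a := 1),
    one_mul]
  intro x hx
  have : X ∩ (fun x => x) ⁻¹' {x} = {x} := by
    ext z
    simp only [mem_inter_iff, mem_preimage, mem_singleton_iff, and_iff_right_iff_imp]
    rintro rfl
    exact hx
  rw [this, hμ.val_image_singleton (hg.mono (singleton_subset_iff.2 hx))]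

open Classical in
/-- The extension of a measure to the definable sets that embed into a power of `C`. -/
noncomputable def baseMeasure (μ : ∀ m, DefOver L C m → A) :
    ∀ (E : Type w) [Coord M E], Set E → A := fun E _ X =>
  if h : ∃ (a : A) (n : ℕ) (g : E → (Fin n → M)), IsEmb L C X g ∧ val μ (g '' X) = a
    then h.choose else 0

theorem IsFubiniMeasure.baseMeasure_eq (hμ : IsFubiniMeasure (DefOver L C) μ)
    (hC : C.Nonempty) {X : Set E} (hX : DefPred L (· ∈ X)) {n : ℕ} {g : E → (Fin n → M)}
    (hg : IsEmb L C X g) : baseMeasure μ E X = val μ (g '' X) := by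
  have hex : ∃ (a : A) (n : ℕ) (g : E → (Fin n → M)), IsEmb L C X g ∧ val μ (g '' X) = a :=
    ⟨_, n, g, hg, rfl⟩
  unfold baseMeasure
  rw [dif_pos hex]
  obtain ⟨m, h, hh, ha⟩ := hex.choose_spec
  rw [← ha]
  exact hμ.val_image_eq hC hX hh hg

theorem Fiberable.exists_isEmb {X : Set E} (hC : C.Nonempty) (hX : Fiberable L C 0 X) :
    ∃ (n : ℕ) (g : E → (Fin n → M)), IsEmb L C X g := by
  obtain ⟨Q, _, n, f, hf, H⟩ := hX.2
  rcases X.eq_empty_or_nonempty with rfl | hne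
  · exact ⟨1, fun _ _ => hC.some, by fun_prop, by simp, by simp⟩
  · obtain ⟨q, hq, hq'⟩ := H Fin.elim0 hne
    exact ⟨n, fun x => f (q, x), by fun_prop, hq, hq'⟩

theorem defPred_forall_mem (hC : DefPred L (· ∈ C)) {n : ℕ} {f : E → (Fin n → M)}
    (hf : DefFun L f) : DefPred L fun x => ∀ i, f x i ∈ C :=
  .forall_finite fun i => by fun_prop

theorem IsFubiniMeasure.baseMeasure_empty (hμ : IsFubiniMeasure (DefOver L C) μ)
    (hC : C.Nonempty) : baseMeasure μ E ∅ = 0 := by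
  rw [hμ.baseMeasure_eq hC (by simp; fun_prop) (n := 1) (g := fun _ _ => hC.some)
    ⟨by fun_prop, by simp, by simp⟩, image_empty, hμ.val_empty]

/-- The images `f(q, S(p))` lie in `C^n`, but their indices do not come from `C`. Stable
embeddedness reindexes them by `c ∈ C^k`. They become fibers of the projection `W → B` inside
`Def(C)`, where (F1) and (F2) for `μ` give finitely many values and definable level sets. -/
theorem IsFubiniMeasure.baseMeasure_simple (hμ : IsFubiniMeasure (DefOver L C) μ)
    (hC : C.Nonempty) (hCd : DefPred L (· ∈ C)) (hst : StablyEmbedded L C) {S : Set (P × E)}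
    (hS : DefPred L (· ∈ S)) (hU : UF L C 0 S) :
    Simple L fun p => baseMeasure μ E (slice S p) := by
  obtain ⟨Q, _, n, f, hf, H⟩ := hU
  have hR : DefPred L fun z : (Q × P) × (Fin n → M) =>
    ∃ x, (z.1.2, x) ∈ S ∧ f (z.1.1, x) = z.2 := by fun_prop
  obtain ⟨k, T, hT, HT⟩ := hst.exists_family
    (R := {z : (Q × P) × (Fin n → M) | ∃ x, (z.1.2, x) ∈ S ∧ f (z.1.1, x) = z.2}) hR
  let W : Set (Fin (k + n) → M) :=
    {z | (∀ i, z i ∈ C) ∧ ((fun i => z (Fin.castAdd n i)), fun j => z (Fin.natAdd k j)) ∈ T}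
  let B : Set (Fin k → M) := {c | ∀ i, c i ∈ C}
  have hπ : DefFun L fun (z : Fin (k + n) → M) i => z (Fin.castAdd n i) := by fun_prop
  have hW : InClass (DefOver L C) W :=
    inClass_defOver_iff.2 ⟨(defPred_forall_mem hCd .id).and (by fun_prop), fun z hz => hz.1⟩
  have hB : InClass (DefOver L C) B :=
    inClass_defOver_iff.2 ⟨defPred_forall_mem hCd .id, fun z hz => hz⟩
  have hm : MapsTo (fun (z : Fin (k + n) → M) i => z (Fin.castAdd n i)) W B :=
    fun z hz i => hz.1 _
  let τ : (Fin k → M) → A := fun c =>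
    val μ (W ∩ (fun (z : Fin (k + n) → M) i => z (Fin.castAdd n i)) ⁻¹' {c})
  have hτf : (τ '' B).Finite := hμ.val_finite isLower_defOver hW hB hπ hm
  have hτd : ∀ a, DefPred L fun c => c ∈ B ∧ τ c = a :=
    hμ.val_definable isLower_defOver hW hB hπ hm
  have key : ∀ p q c, InjOn (fun x => f (q, x)) (slice S p) →
      (∀ x ∈ slice S p, ∀ i, f (q, x) i ∈ C) → c ∈ B →
      (∀ y : Fin n → M, (∀ j, y j ∈ C) → ((∃ x, (p, x) ∈ S ∧ f (q, x) = y) ↔ (c, y) ∈ T)) →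
      baseMeasure μ E (slice S p) = τ c := by
    intro p q c h1 h2 h3 h4
    have hSp : DefPred L (· ∈ slice S p) := by simp only [mem_slice]; fun_prop
    -- Prefixing the constant tuple `c` makes the image equal to the fiber of `W` over `c`, which
    -- lives in `C^(k+n)`.
    have hemb : IsEmb L C (slice S p) fun x => Fin.append c (f (q, x)) := by
      refine ⟨by fun_prop, fun x hx y hy h => h1 hx hy ?_, fun x hx i => ?_⟩
      · exact congrArg Prod.snd ((Fin.appendEquiv k n).injective
          (a₁ := (c, f (q, x))) (a₂ := (c, f (q, y))) h)
      · induction i using Fin.addCases with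
        | left i => simpa using h3 i
        | right i => simpa using h2 x hx i
    rw [hμ.baseMeasure_eq hC hSp hemb]
    congr 1
    ext z
    constructor
    · rintro ⟨x, hx, rfl⟩
      refine ⟨⟨hemb.mem x hx, ?_⟩, ?_⟩
      · simpa using (h4 _ (h2 x hx)).1 ⟨x, hx, rfl⟩
      · simp
    · rintro ⟨⟨hz, hzT⟩, rfl⟩
      obtain ⟨x, hx, hxz⟩ := (h4 _ fun j => hz _).2 hzT
      refine ⟨x, hx, ?_⟩
      simp only [hxz]
      exact Fin.append_castAdd_natAdd
  have hex : ∀ p, (slice S p).Nonempty → ∃ q c, InjOn (fun x => f (q, x)) (slice S p) ∧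
      (∀ x ∈ slice S p, ∀ i, f (q, x) i ∈ C) ∧ c ∈ B ∧
      (∀ y : Fin n → M, (∀ j, y j ∈ C) → ((∃ x, (p, x) ∈ S ∧ f (q, x) = y) ↔ (c, y) ∈ T)) := by
    intro p hp
    obtain ⟨q, hq, hq'⟩ := H p hp
    obtain ⟨c, hc, hc'⟩ := HT (q, p)
    exact ⟨q, c, hq, hq', hc, hc'⟩
  refine ⟨(hτf.insert 0).subset ?_, fun a => ?_⟩
  · rintro _ ⟨p, rfl⟩
    rcases (slice S p).eq_empty_or_nonempty with hp | hp
    · left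
      simp only [hp, hμ.baseMeasure_empty hC]
    · obtain ⟨q, c, h1, h2, h3, h4⟩ := hex p hp
      right
      exact ⟨c, h3, (key p q c h1 h2 h3 h4).symm⟩
  · have d1 := DefPred.injOn_slice hS hf
    have d2 : DefPred L fun z : P × Q => ∀ x, (z.1, x) ∈ S → ∀ i, f (z.2, x) i ∈ C :=
      .all (.imp (by fun_prop) (defPred_forall_mem hCd (by fun_prop)))
    have d3 : DefPred L fun z : (P × Q) × (Fin k → M) => ∀ y : Fin n → M, (∀ j, y j ∈ C) →
        ((∃ x, (z.1.1, x) ∈ S ∧ f (z.1.2, x) = y) ↔ (z.2, y) ∈ T) :=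
      .all (.imp (defPred_forall_mem hCd (by fun_prop)) (by fun_prop))
    -- The choices of `q` and `c` are quantified away, since by `key` every admissible choice gives
    -- the same value; empty slices are again separate.
    have d4 : DefPred L fun p => ((¬ ∃ x, (p, x) ∈ S) ∧ 0 = a) ∨ ((∃ x, (p, x) ∈ S) ∧
        ∃ q, ∃ c, InjOn (fun x => f (q, x)) (slice S p) ∧
          (∀ x, (p, x) ∈ S → ∀ i, f (q, x) i ∈ C) ∧ (∀ y : Fin n → M, (∀ j, y j ∈ C) →
            ((∃ x, (p, x) ∈ S ∧ f (q, x) = y) ↔ (c, y) ∈ T)) ∧ (c ∈ B ∧ τ c = a)) := by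
      refine .or (by fun_prop) (.and (by fun_prop) (.ex (.ex (.and ?_ (.and ?_ (.and d3 ?_))))))
      · exact d1.comp (f := fun z : (P × Q) × (Fin k → M) => z.1) (by fun_prop)
      · exact d2.comp (f := fun z : (P × Q) × (Fin k → M) => z.1) (by fun_prop)
      · exact (hτd a).comp (f := fun z : (P × Q) × (Fin k → M) => z.2) (by fun_prop)
    refine d4.congr fun p => ?_
    by_cases hp : ∃ x, (p, x) ∈ S
    · simp only [hp, not_true, false_and, false_or, true_and]
      constructor
      · rintro ⟨q, c, h1, h2, h4, h3, h5⟩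
        rw [key p q c h1 h2 h3 h4, h5]
      · rintro rfl
        obtain ⟨q, c, h1, h2, h3, h4⟩ := hex p (by obtain ⟨x, hx⟩ := hp; exact ⟨x, hx⟩)
        exact ⟨q, c, h1, h2, h4, h3, (key p q c h1 h2 h3 h4).symm⟩
    · have : slice S p = ∅ := eq_empty_of_forall_notMem fun x hx => hp ⟨x, hx⟩
      simp only [hp, this, hμ.baseMeasure_empty hC, not_false_iff, true_and, false_and, or_false]

theorem IsFubiniMeasure.isMeasure_baseMeasure (hμ : IsFubiniMeasure (DefOver L C) μ)
    (hC : C.Nonempty) (hCd : DefPred L (· ∈ C)) (hst : StablyEmbedded L C) :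
    IsMeasure L C 0 (baseMeasure μ) where
  simple := hμ.baseMeasure_simple hC hCd hst
  empty _ _ := hμ.baseMeasure_empty hC
  singleton {E _} x := by
    obtain ⟨n, g, hg⟩ := (Fiberable.singleton (L := L) hC 0 x).exists_isEmb hC
    rw [hμ.baseMeasure_eq hC (by simp only [mem_singleton_iff]; fun_prop) hg,
      hμ.val_image_singleton hg]
  union {E _ X Y} hXY hX hY hd := by
    obtain ⟨n, g, hg⟩ := hXY.exists_isEmb hC
    have hgX := hg.mono (Y := X) subset_union_left
    have hgY := hg.mono (Y := Y) subset_union_right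
    rw [hμ.baseMeasure_eq hC hXY.1 hg, hμ.baseMeasure_eq hC hX hgX, hμ.baseMeasure_eq hC hY hgY,
      image_union]
    refine hμ.val_union isLower_defOver (hX.image hg.defFun) (hY.image hg.defFun)
      (image_union g X Y ▸ hg.inClass hXY.1) ?_
    rw [disjoint_left]
    rintro _ ⟨x, hx, rfl⟩ ⟨y, hy, h⟩
    obtain rfl := hg.injOn (.inr hy) (.inl hx) h
    exact disjoint_left.1 hd hx hy
  fubini {E F _ _ X Y f a} hX hY hf hm ha := by
    obtain ⟨m, g, hg⟩ := hX.exists_isEmb hC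
    obtain ⟨n, h, hh⟩ := hY.exists_isEmb hC
    rw [hμ.baseMeasure_eq hC hX.1 hg, hμ.baseMeasure_eq hC hY.1 hh]
    refine hμ.val_image_fubini hC hX.1 hY.1 hf hm hg hh fun y hy => ?_
    have hXy : DefPred L (· ∈ X ∩ f ⁻¹' {y}) := hX.1.and (DefPred.eq hf (.const y))
    rw [← ha y hy, hμ.baseMeasure_eq hC hXy (hg.mono inter_subset_left)]

end

/-! ### Fibering tuples compared with uniform fiberability. -/

section

variable {L : FirstOrder.Language.{u, v}} {M : Type w} [L.Structure M] {C : Set M}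
variable {P Q E F G : Type w} [Coord M P] [Coord M Q] [Coord M E] [Coord M F] [Coord M G]

theorem DefFamily.defPred_mem {p m n : ℕ} (f : DefFamily L M p m n) :
    DefPred L fun z : ((Fin p → M) × (Fin m → M)) × (Fin n → M) =>
      z.2 ∈ f.toFun z.1.1 z.1.2 :=
  f.definable

theorem DefFamily.exists_total {p m n : ℕ} (f : DefFamily L M p m n) (y₀ : Fin n → M) :
    ∃ g : (Fin p → M) × (Fin m → M) → (Fin n → M), DefFun L g ∧
      ∀ a x y, y ∈ f.toFun a x → g (a, x) = y := by
  obtain ⟨g, hg, H⟩ := exists_defFun_of_graph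
    (R := {z : ((Fin p → M) × (Fin m → M)) × (Fin n → M) | z.2 ∈ f.toFun z.1.1 z.1.2})
    f.defPred_mem (fun x y y' h h' => Part.mem_unique h h') y₀
  exact ⟨g, hg, fun a x y h => H _ _ h⟩

/-- Being a fibering is a first-order condition on the parameters. `FiberingTuple.uf` uses this to
discard values of the parameter variables at which the remaining tuple is not a fibering. -/
theorem FiberingTuple.defPred_isFibering (hC : DefPred L (· ∈ C)) {r p m : ℕ}
    (D : FiberingTuple L M r p m) {S : Set (Q × (Fin m → M))} (hS : DefPred L (· ∈ S))
    {α : Q → (Fin p → M)} (hα : DefFun L α) :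
    DefPred L fun q => D.IsFibering C (α q) (slice S q) := by
  induction D generalizing Q with
  | @base p m n f =>
    have hG := f.defPred_mem
    have h1 : DefPred L fun q => ∀ x, (∃ y, y ∈ f.toFun (α q) x) ↔ (q, x) ∈ S :=
      .all (.iff (.ex (hG.comp (f := fun z : (Q × (Fin m → M)) × (Fin n → M) =>
        ((α z.1.1, z.1.2), z.2)) (by fun_prop))) (by fun_prop))
    have h2 : DefPred L fun q => ∀ x x' y, y ∈ f.toFun (α q) x → y ∈ f.toFun (α q) x' → x = x' :=
      .all (.all (.all (.imp
        (hG.comp (f := fun z : ((Q × (Fin m → M)) × (Fin m → M)) × (Fin n → M) =>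
          ((α z.1.1.1, z.1.1.2), z.2)) (by fun_prop))
        (.imp (hG.comp (f := fun z : ((Q × (Fin m → M)) × (Fin m → M)) × (Fin n → M) =>
          ((α z.1.1.1, z.1.2), z.2)) (by fun_prop)) (by fun_prop)))))
    have h3 : DefPred L fun q => ∀ y, (∃ x, y ∈ f.toFun (α q) x) → ∀ i, y i ∈ C :=
      .all (.imp (.ex (hG.comp (f := fun z : (Q × (Fin n → M)) × (Fin m → M) =>
        ((α z.1.1, z.2), z.1.2)) (by fun_prop))) (defPred_forall_mem hC (by fun_prop)))
    refine (h1.and (h2.and h3)).congr fun q => and_congr ?_ Iff.rfl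
    rw [Set.ext_iff]
    refine forall_congr' fun x => iff_congr ?_ Iff.rfl
    exact Part.dom_iff_mem.symm
  | @step r p m n k f rest ih =>
    have hG := f.defPred_mem
    have h1 : DefPred L fun q => ∀ x, (∃ y, y ∈ f.toFun (α q) x) ↔ (q, x) ∈ S :=
      .all (.iff (.ex (hG.comp (f := fun z : (Q × (Fin m → M)) × (Fin n → M) =>
        ((α z.1.1, z.1.2), z.2)) (by fun_prop))) (by fun_prop))
    have hS' : DefPred L (· ∈ {z : ((Q × (Fin n → M)) × (Fin k → M)) × (Fin (m + n) → M) |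
        z.1.1.2 ∈ f.toFun (α z.1.1.1) (fun i => z.2 (Fin.castAdd n i)) ∧
        ∃ x, (fun i => z.2 (Fin.natAdd m i)) ∈ f.toFun (α z.1.1.1) x}) := by
      refine .and (hG.comp (f := fun z : ((Q × (Fin n → M)) × (Fin k → M)) × (Fin (m + n) → M) =>
        ((α z.1.1.1, fun i => z.2 (Fin.castAdd n i)), z.1.1.2)) (by fun_prop)) (.ex ?_)
      exact (hG.comp (f := fun z : (((Q × (Fin n → M)) × (Fin k → M)) × (Fin (m + n) → M)) ×
        (Fin m → M) => ((α z.1.1.1.1, z.2), fun i => z.1.2 (Fin.natAdd m i))) (by fun_prop))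
    have h2 := ih hS' (α := fun z => Fin.append (α z.1.1) z.2) (by fun_prop)
    have h3 : DefPred L fun q => ∀ y, (∃ x, y ∈ f.toFun (α q) x) → ∃ x : Fin k → M,
        rest.IsFibering C (Fin.append (α q) x) (slice _ ((q, y), x)) :=
      .all (.imp (.ex (hG.comp (f := fun z : (Q × (Fin n → M)) × (Fin m → M) =>
        ((α z.1.1, z.2), z.1.2)) (by fun_prop))) (.ex h2))
    refine (h1.and h3).congr fun q => and_congr ?_ ?_
    · rw [Set.ext_iff]
      refine forall_congr' fun x => iff_congr ?_ Iff.rfl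
      exact Part.dom_iff_mem.symm
    · refine forall_congr' fun y => imp_congr Iff.rfl (exists_congr fun x => iff_of_eq ?_)
      congr 1
      ext z
      simp [slice, prodSet, PFun.mem_preimage, PFun.ran]

/-- Because the later maps are shared, the induction hypothesis applies to the family of all
products of a fiber with the range. Each factor embeds in the product by fixing a point of the
other. -/
theorem FiberingTuple.uf (hC : DefPred L (· ∈ C)) (hC' : C.Nonempty) {r p m : ℕ}
    (D : FiberingTuple L M r p m) {S : Set (Q × (Fin m → M))} (hS : DefPred L (· ∈ S))
    {α : Q → (Fin p → M)} (hα : DefFun L α)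
    (H : ∀ q, (slice S q).Nonempty → D.IsFibering C (α q) (slice S q)) : UF L C r S := by
  induction D generalizing Q with
  | @base p m n f =>
    obtain ⟨g, hg, hgf⟩ := f.exists_total fun _ => hC'.some
    refine ⟨Q, inferInstance, n, fun z => g (α z.1, z.2), by fun_prop, fun q hq => ?_⟩
    obtain ⟨hd, hi, hr⟩ := H q hq
    have hm : ∀ x ∈ slice S q, g (α q, x) ∈ f.toFun (α q) x := fun x hx => by
      rw [← hd] at hx
      obtain ⟨y, hy⟩ := Part.dom_iff_mem.1 hx
      rwa [hgf _ _ _ hy]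
    refine ⟨q, fun x hx x' hx' h => hi x x' _ (hm x hx) ?_, fun x hx => hr _ ⟨x, hm x hx⟩⟩
    rw [show g (α q, x) = g (α q, x') from h]
    exact hm x' hx'
  | @step r p m n k f rest ih =>
    obtain ⟨g, hg, hgf⟩ := f.exists_total fun _ => hC'.some
    have hm : ∀ q, (slice S q).Nonempty → ∀ x y, y ∈ f.toFun (α q) x ↔
        (q, x) ∈ S ∧ g (α q, x) = y := fun q hq x y => by
      have hd : x ∈ (f.toFun (α q)).Dom ↔ (q, x) ∈ S := Set.ext_iff.1 (H q hq).1 x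
      rw [← hd]
      refine ⟨fun h => ⟨Part.dom_iff_mem.2 ⟨y, h⟩, hgf _ _ _ h⟩, ?_⟩
      rintro ⟨h, rfl⟩
      obtain ⟨y, hy⟩ := Part.dom_iff_mem.1 h
      rwa [hgf _ _ _ hy]
    let S' : Set (((Q × (Fin n → M)) × (Fin k → M)) × (Fin (m + n) → M)) :=
      {z | ((z.1.1.1, fun i => z.2 (Fin.castAdd n i)) ∈ S ∧
        g (α z.1.1.1, fun i => z.2 (Fin.castAdd n i)) = z.1.1.2) ∧
        ∃ x, (z.1.1.1, x) ∈ S ∧ g (α z.1.1.1, x) = fun i => z.2 (Fin.natAdd m i)}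
    have hS' : DefPred L (· ∈ S') := by
      simp only [S', mem_ofPred_eq]
      fun_prop
    have hα' : DefFun L fun z : (Q × (Fin n → M)) × (Fin k → M) => Fin.append (α z.1.1) z.2 := by
      fun_prop
    -- A bad choice of the parameter variables gives the empty slice, a good one the whole product
    -- (`hslice`).
    let S'' : Set (((Q × (Fin n → M)) × (Fin k → M)) × (Fin (m + n) → M)) :=
      {z | z ∈ S' ∧ rest.IsFibering C (Fin.append (α z.1.1.1) z.1.2) (slice S' z.1)}
    have hS'' : DefPred L (· ∈ S'') :=
      hS'.and ((rest.defPred_isFibering hC hS' hα').comp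
        (f := fun z : ((Q × (Fin n → M)) × (Fin k → M)) × (Fin (m + n) → M) => z.1) .fst_id)
    have hslice : ∀ q, (slice S'' q).Nonempty → slice S'' q = slice S' q := by
      rintro q ⟨x, -, hx⟩
      ext z
      exact ⟨fun h => h.1, fun h => ⟨h, hx⟩⟩
    have hU := ih hS'' hα' fun q hq => by
      rw [hslice q hq]
      obtain ⟨x, -, hx⟩ := hq
      exact hx
    have hgα : DefFun L fun z : Q × (Fin m → M) => g (α z.1, z.2) := by fun_prop
    have key : ∀ q x, (q, x) ∈ S → ∃ x₀, ∀ z, z ∈ slice S' ((q, g (α q, x)), x₀) →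
        z ∈ slice S'' ((q, g (α q, x)), x₀) := by
      intro q x hx
      have hq : (slice S q).Nonempty := ⟨x, hx⟩
      obtain ⟨x₀, hx₀⟩ := (H q hq).2 (g (α q, x)) ⟨x, (hm q hq _ _).2 ⟨hx, rfl⟩⟩
      refine ⟨x₀, fun z hz => ⟨hz, ?_⟩⟩
      convert hx₀ using 1
      ext z
      simp [slice, S', prodSet, PFun.mem_preimage, PFun.ran, hm q hq]
    refine ⟨Q, inferInstance, Fin n → M, inferInstance, _, S, hgα, hS, fun q _ => ⟨q, rfl⟩, ?_, ?_⟩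
    -- A fiber over `y` is paired with the point `y` of the range.
    · refine hU.of_injOn (Q := Fin n → M) (hgα.defPred_fibers hS)
        (g := fun z : (Fin n → M) × (Fin m → M) => Fin.append z.2 z.1) (by fun_prop) ?_
      rintro ⟨q, y⟩ ⟨x, hx, hxy⟩
      obtain rfl : g (α q, x) = y := hxy
      obtain ⟨x₀, hx₀⟩ := key q x hx
      refine ⟨g (α q, x), ((q, g (α q, x)), x₀), fun a _ b _ h => ?_, fun a ha => hx₀ _ ?_⟩
      · exact congrArg Prod.fst ((Fin.appendEquiv m n).injective
          (a₁ := (a, g (α q, x))) (a₂ := (b, g (α q, x))) h)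
      · simp only [mem_slice, S', mem_ofPred_eq, Fin.append_left, Fin.append_right]
        exact ⟨ha, x, hx, rfl⟩
    -- The range is paired with a point `x` of the fiber over `g (α q, x)`.
    · refine hU.of_injOn (Q := Fin m → M) (hgα.defPred_ranges hS)
        (g := fun z : (Fin m → M) × (Fin n → M) => Fin.append z.1 z.2) (by fun_prop) ?_
      rintro q ⟨y, x, hx, hxy⟩
      obtain rfl : g (α q, x) = y := hxy
      obtain ⟨x₀, hx₀⟩ := key q x hx
      refine ⟨x, ((q, g (α q, x)), x₀), fun a _ b _ h => ?_, fun a ha => hx₀ _ ?_⟩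
      · exact congrArg Prod.snd ((Fin.appendEquiv m n).injective
          (a₁ := (x, a)) (a₂ := (x, b)) h)
      · simp only [mem_slice, S', mem_ofPred_eq, Fin.append_left, Fin.append_right]
        exact ⟨⟨hx, trivial⟩, ha⟩

/-- The definable family of partial maps given by a total definable map and a definable domain. -/
def DefFamily.ofTotal {p m n : ℕ} (h : (Fin p → M) × (Fin m → M) → (Fin n → M))
    (D : Set ((Fin p → M) × (Fin m → M))) (hh : DefFun L h) (hD : DefPred L (· ∈ D)) :
    DefFamily L M p m n where
  toFun a x := ⟨(a, x) ∈ D, fun _ => h (a, x)⟩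
  definable := by
    have : DefPred L fun z : ((Fin p → M) × (Fin m → M)) × (Fin n → M) =>
      z.1 ∈ D ∧ h z.1 = z.2 := by fun_prop
    exact DefPred.congr this (q := fun z : ((Fin p → M) × (Fin m → M)) × (Fin n → M) =>
      z.2 ∈ (⟨z.1 ∈ D, fun _ => h z.1⟩ : Part (Fin n → M))) fun z => by simp [Part.mem_mk_iff]

theorem DefFamily.mem_ofTotal {p m n : ℕ} {h : (Fin p → M) × (Fin m → M) → (Fin n → M)}
    {D : Set ((Fin p → M) × (Fin m → M))} {hh : DefFun L h} {hD : DefPred L (· ∈ D)}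
    {a : Fin p → M} {x : Fin m → M} {y : Fin n → M} :
    y ∈ (DefFamily.ofTotal h D hh hD).toFun a x ↔ (a, x) ∈ D ∧ h (a, x) = y := by
  simp [DefFamily.ofTotal, Part.mem_mk_iff]

theorem DefFamily.dom_ofTotal {p m n : ℕ} {h : (Fin p → M) × (Fin m → M) → (Fin n → M)}
    {D : Set ((Fin p → M) × (Fin m → M))} {hh : DefFun L h} {hD : DefPred L (· ∈ D)}
    {a : Fin p → M} :
    ((DefFamily.ofTotal h D hh hD).toFun a).Dom = slice D a := rfl

theorem UF.prodSet {r m n : ℕ} {S : Set (P × (Fin m → M))} (hS : UF L C r S)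
    (hSd : DefPred L (· ∈ S)) {S' : Set (P × F)} (hS' : UF L C r S') (hSd' : DefPred L (· ∈ S'))
    {e : F ≃ (Fin n → M)} (he : DefFun L e.symm) :
    UF L C r {z : P × (Fin (m + n) → M) | (z.1, fun i => z.2 (Fin.castAdd n i)) ∈ S ∧
      (z.1, e.symm fun i => z.2 (Fin.natAdd m i)) ∈ S'} := by
  refine (hS.prod hS').of_injOn (Q := P) (by simp only [mem_ofPred_eq]; fun_prop)
    (g := fun z => (fun i => z.2 (Fin.castAdd n i), e.symm fun i => z.2 (Fin.natAdd m i)))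
    (by fun_prop) fun p _ => ⟨p, (p, p), fun x _ y _ h => ?_, fun x hx => hx⟩
  simp only [Prod.mk.injEq, EmbeddingLike.apply_eq_iff_eq] at h
  funext i
  induction i using Fin.addCases with
  | left i => exact congrFun h.1 i
  | right i => exact congrFun h.2 i

/-- A converse to `FiberingTuple.uf`: the indices in `UF` become parameter variables. The number `p`
counts the variables accumulated so far; each map reads only its own block, hence the arbitrary `a`.
-/
theorem UF.exists_fiberingTuple {r m : ℕ} {S : Set (P × (Fin m → M))} (hS : UF L C r S)
    (hSd : DefPred L (· ∈ S)) (p : ℕ) :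
    ∃ (k : ℕ) (D : FiberingTuple L M r (p + k) m), ∀ (a : Fin p → M) (t : P),
      (slice S t).Nonempty → ∃ x : Fin k → M, D.IsFibering C (Fin.append a x) (slice S t) := by
  induction r generalizing m P p with
  | zero =>
    obtain ⟨Q, _, n, f, hf, H⟩ := hS
    -- The variables encode `t` besides `q`: `f` is total, while the domain of the fibering map must
    -- be exactly `S(t)`.
    obtain ⟨k, e, he, he'⟩ := exists_equiv_fin L (Q × P)
    refine ⟨k, .base (.ofTotal (fun z => f ((e.symm fun i => z.1 (Fin.natAdd p i)).1, z.2))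
      {z | ((e.symm fun i => z.1 (Fin.natAdd p i)).2, z.2) ∈ S} (by fun_prop)
      (by simp only [mem_ofPred_eq]; fun_prop)), fun a t ht => ?_⟩
    obtain ⟨q, hq, hq'⟩ := H t ht
    refine ⟨e (q, t), ?_, ?_, ?_⟩
    · rw [DefFamily.dom_ofTotal]
      ext x
      simp [slice]
    · simp only [DefFamily.mem_ofTotal, mem_ofPred_eq, Fin.append_right, Equiv.symm_apply_apply]
      rintro x x' y ⟨hx, rfl⟩ ⟨hx', h⟩
      exact hq hx hx' h.symm
    · simp only [PFun.ran, DefFamily.mem_ofTotal, mem_ofPred_eq, Fin.append_right,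
        Equiv.symm_apply_apply]
      rintro y ⟨x, hx, rfl⟩
      exact hq' x hx
  | succ r ih =>
    obtain ⟨Q, _, F, _, f, D, hf, hD, H, hfib, hran⟩ := hS
    obtain ⟨k, e, he, he'⟩ := exists_equiv_fin L Q
    obtain ⟨n, eF, heF, heF'⟩ := exists_equiv_fin L F
    have hfd := hf.defPred_fibers hD
    have hrd := hf.defPred_ranges hD
    have hrd' : DefPred L (· ∈ {z : (Q × F) × F | (z.1.1, z.2) ∈ ranges f D}) := by
      simp only [mem_ofPred_eq]
      fun_prop
    have hran' := hran.of_subset hrd' fun z _ => ⟨z.1, fun x hx => hx⟩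
    obtain ⟨k', D', hD'⟩ := ih (hfib.prodSet hfd hran' hrd' heF')
      (by simp only [mem_ofPred_eq] at hrd' ⊢; fun_prop) (p + k)
    refine ⟨k, .step (.ofTotal (fun z => eF (f (e.symm fun i => z.1 (Fin.natAdd p i), z.2)))
      {z | (e.symm fun i => z.1 (Fin.natAdd p i), z.2) ∈ D} (by fun_prop)
      (by simp only [mem_ofPred_eq]; fun_prop)) D', fun a t ht => ?_⟩
    obtain ⟨q, hq⟩ := H t ht
    refine ⟨e q, ?_, ?_⟩
    · rw [DefFamily.dom_ofTotal, ← hq]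
      ext x
      simp [slice]
    · simp only [PFun.ran, DefFamily.mem_ofTotal, mem_ofPred_eq, Fin.append_right,
        Equiv.symm_apply_apply]
      rintro y ⟨x, hx, rfl⟩
      have hne : (slice {z : (Q × F) × (Fin (m + n) → M) |
          (z.1, fun i => z.2 (Fin.castAdd n i)) ∈ fibers f D ∧
          (z.1, eF.symm fun i => z.2 (Fin.natAdd m i)) ∈
            {z : (Q × F) × F | (z.1.1, z.2) ∈ ranges f D}} (q, f (q, x))).Nonempty := by
        refine ⟨Fin.append x (eF (f (q, x))), ?_⟩
        simp only [mem_slice, mem_ofPred_eq, Fin.append_left, Fin.append_right, mem_fibers,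
          mem_ranges, Equiv.symm_apply_apply]
        exact ⟨⟨hx, trivial⟩, x, hx, rfl⟩
      obtain ⟨x', hx'⟩ := hD' (Fin.append a (e q)) (q, f (q, x)) hne
      refine ⟨x', ?_⟩
      convert hx' using 1
      ext z
      simp [slice, FubiniExt.prodSet, PFun.mem_preimage, DefFamily.mem_ofTotal, Equiv.eq_symm_apply]

/-- From right to left, the first map of a fibering has no parameter variables but may use
parameters from `M`, so its index is frozen; the later maps come from `UF.exists_fiberingTuple`. -/
theorem isStepFiberable_iff (hC : DefPred L (· ∈ C)) (hC' : C.Nonempty) {r m : ℕ}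
    {X : DefSet L M m} :
    IsStepFiberable C r X ↔ Fiberable L C r (X : Set (Fin m → M)) := by
  have hX : DefPred L (· ∈ (X : Set (Fin m → M))) := X.2
  constructor
  · rintro ⟨D, hD⟩
    refine ⟨hX, D.uf hC hC' (α := fun q => q) (by simp only [mem_ofPred_eq]; fun_prop)
      (by fun_prop) fun q _ => ?_⟩
    rw [Subsingleton.elim q Fin.elim0]
    exact hD
  · intro h
    have hX' : DefPred L (· ∈ {z : (Fin 0 → M) × (Fin m → M) | z.2 ∈ (X : Set (Fin m → M))}) := by
      simp only [mem_ofPred_eq]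
      fun_prop
    cases r with
    | zero =>
      obtain ⟨n, g, hg⟩ := h.exists_isEmb hC'
      have hgd : DefFun L fun z : (Fin 0 → M) × (Fin m → M) => g z.2 := hg.defFun.comp .snd_id
      refine ⟨.base (.ofTotal _ _ hgd hX'), DefFamily.dom_ofTotal, ?_, ?_⟩
      · simp only [DefFamily.mem_ofTotal, mem_ofPred_eq]
        rintro x x' y ⟨hx, rfl⟩ ⟨hx', h⟩
        exact hg.injOn hx hx' h.symm
      · simp only [PFun.ran, DefFamily.mem_ofTotal, mem_ofPred_eq]
        rintro y ⟨x, hx, rfl⟩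
        exact hg.mem x hx
    | succ r =>
      obtain ⟨F, _, f, Y, hf⟩ := h.exists_fibration
      have hfd := hf.defFun
      obtain ⟨n, e, he, he'⟩ := exists_equiv_fin L F
      have hfam := defPred_fiberFam hX hfd
      have him := hX.image hfd
      have hran : DefPred L (· ∈ {z : F × F | z.2 ∈ f '' (X : Set (Fin m → M))}) := by
        simp only [mem_ofPred_eq]
        fun_prop
      have hran' := hf.base.family hran fun y => hf.mapsTo.image_subset
      obtain ⟨k, D, hD⟩ := (hf.fibers.prodSet hfam hran' hran he').exists_fiberingTuple
        (by simp only [mem_ofPred_eq] at hran ⊢; fun_prop) 0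
      have hed : DefFun L fun z : (Fin 0 → M) × (Fin m → M) => e (f z.2) := by fun_prop
      refine ⟨.step (.ofTotal _ _ hed hX') D, DefFamily.dom_ofTotal, ?_⟩
      simp only [PFun.ran, DefFamily.mem_ofTotal, mem_ofPred_eq]
      rintro y ⟨x, hx, rfl⟩
      obtain ⟨x', hx'⟩ := hD Fin.elim0 (f x) ⟨Fin.append x (e (f x)), by
        simp only [mem_slice, mem_ofPred_eq, Fin.append_left, Fin.append_right, fiberFam,
          Equiv.symm_apply_apply]
        exact ⟨⟨hx, trivial⟩, x, hx, rfl⟩⟩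
      refine ⟨x', ?_⟩
      convert hx' using 1
      ext z
      simp [slice, FubiniExt.prodSet, fiberFam, PFun.mem_preimage, DefFamily.mem_ofTotal,
        Equiv.eq_symm_apply]

theorem mem_defFiberable_iff (hC : DefPred L (· ∈ C)) (hC' : C.Nonempty) {m : ℕ}
    {X : DefSet L M m} :
    X ∈ DefFiberable L C m ↔ ∃ r, Fiberable L C r (X : Set (Fin m → M)) :=
  exists_congr fun _ => isStepFiberable_iff hC hC'

end

/-! ### Gluing the levels, admissibility and uniqueness. -/

section

variable {L : FirstOrder.Language.{u, v}} {M : Type w} [L.Structure M] {C : Set M}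
variable {E F : Type w} [Coord M E] [Coord M F]
variable {A : Type t} [CommSemiring A]

theorem IsFubiniMeasure.val_sum_pieces {𝒞 : ObjClass L M} {μ : ∀ m, 𝒞 m → A}
    (hμ : IsFubiniMeasure 𝒞 μ) (h𝒞 : IsLower 𝒞) {m : ℕ} {X : Set (Fin m → M)}
    (hX : InClass 𝒞 X) {T : Type*} {ψ : (Fin m → M) → T} (hψ : Simple L ψ) (s : Finset T) :
    val μ (X ∩ ψ ⁻¹' s) = ∑ b ∈ s, val μ (X ∩ ψ ⁻¹' {b}) := by
  classical
  induction s using Finset.induction_on with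
  | empty => simp [hμ.val_empty]
  | insert b s hb ih =>
    have hs : DefPred L (· ∈ X ∩ ψ ⁻¹' s) := by
      refine (hX.defPred.and (DefPred.exists_finset s (p := fun b x => ψ x = b)
        fun b _ => hψ.def_level b)).congr fun x => ?_
      simp
    have hb' := defPred_inter_preimage hX.defPred hψ b
    have heq : X ∩ ψ ⁻¹' (insert b s : Finset T) = (X ∩ ψ ⁻¹' {b}) ∪ (X ∩ ψ ⁻¹' s) := by
      rw [← inter_union_distrib_left, ← preimage_union, Finset.coe_insert, insert_eq]
    rw [Finset.sum_insert hb, ← ih, heq]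
    refine hμ.val_union h𝒞 hb' hs (hX.subset h𝒞 (hb'.or hs) (by simp)) ?_
    refine disjoint_left.2 fun x hx hx' => hb ?_
    rw [← show ψ x = b from hx.2]
    exact hx'.2

variable (L C) in
/-- The successive extensions of a measure on `Def(C)` to the `r`-fiberable sets. -/
noncomputable def measureSeq (μ : ∀ m, DefOver L C m → A) :
    ℕ → ∀ (E : Type w) [Coord M E], Set E → A
  | 0 => baseMeasure μ
  | r + 1 => stepMeasure L C r (measureSeq μ r)

variable {μ : ∀ m, DefOver L C m → A}

theorem IsFubiniMeasure.isMeasure_measureSeq (hμ : IsFubiniMeasure (DefOver L C) μ)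
    (hC : C.Nonempty) (hCd : DefPred L (· ∈ C)) (hst : StablyEmbedded L C) (r : ℕ) :
    IsMeasure L C r (measureSeq L C μ r) := by
  induction r with
  | zero => exact hμ.isMeasure_baseMeasure hC hCd hst
  | succ r ih => exact ih.step hC

/-- This is what makes `limMeasure` independent of the level chosen for a set. -/
theorem IsFubiniMeasure.measureSeq_mono (hμ : IsFubiniMeasure (DefOver L C) μ)
    (hC : C.Nonempty) (hCd : DefPred L (· ∈ C)) (hst : StablyEmbedded L C) {r s : ℕ}
    (hrs : r ≤ s) {X : Set E} (hX : Fiberable L C r X) :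
    measureSeq L C μ s E X = measureSeq L C μ r E X := by
  induction s, hrs using Nat.le_induction with
  | base => rfl
  | succ s hrs ih =>
    rw [← ih]
    exact (hμ.isMeasure_measureSeq hC hCd hst s).stepMeasure_of_fiberable hC (hX.mono hrs)

theorem inClass_defFiberable_iff (hC : C.Nonempty) (hCd : DefPred L (· ∈ C)) {m : ℕ}
    {X : Set (Fin m → M)} : InClass (DefFiberable L C) X ↔ ∃ r, Fiberable L C r X := by
  constructor
  · rintro ⟨F, rfl⟩
    exact (mem_defFiberable_iff hCd hC).1 F.2
  · rintro ⟨r, h⟩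
    exact ⟨⟨⟨X, h.1⟩, (mem_defFiberable_iff hCd hC).2 ⟨r, h⟩⟩, rfl⟩

theorem isAdmissible_defFiberable (hC : C.Nontrivial) (hCd : DefPred L (· ∈ C)) :
    IsAdmissible (DefFiberable L C) where
  union_mem X Y hX hY := by
    rw [mem_defFiberable_iff hCd hC.nonempty] at *
    obtain ⟨r, hX⟩ := hX
    obtain ⟨s, hY⟩ := hY
    exact ⟨max r s, (hX.mono (le_max_left r s)).union hCd hC (hY.mono (le_max_right r s))⟩
  subset_mem X Y hX h := by
    rw [mem_defFiberable_iff hCd hC.nonempty] at *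
    obtain ⟨r, hX⟩ := hX
    exact ⟨r, hX.subset Y.2 h⟩
  prod_mem {m n} X Y hX hY := by
    rw [mem_defFiberable_iff hCd hC.nonempty] at *
    obtain ⟨r, hX⟩ := hX
    obtain ⟨s, hY⟩ := hY
    refine ⟨max r s, ((hX.mono (le_max_left r s)).prod (hY.mono (le_max_right r s))).of_injOn
      (X.prod Y).2 (g := fun z => (fun i => z (Fin.castAdd n i), fun i => z (Fin.natAdd m i)))
      (by fun_prop) ?_ fun z hz => hz⟩
    intro x _ y _ h
    simp only [Prod.mk.injEq] at h
    funext i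
    induction i using Fin.addCases with
    | left i => exact congrFun h.1 i
    | right i => exact congrFun h.2 i

theorem isLower_defFiberable (hC : C.Nontrivial) (hCd : DefPred L (· ∈ C)) :
    IsLower (DefFiberable L C) := (isAdmissible_defFiberable hC hCd).subset_mem

theorem defOver_subset_defFiberable (hC : C.Nonempty) (hCd : DefPred L (· ∈ C)) (m : ℕ) :
    DefOver L C m ⊆ DefFiberable L C m := fun X hX =>
  (mem_defFiberable_iff hCd hC).2 ⟨0, .of_mem X.2 hX 0⟩

/-- The base is moved into a power of `M`, so that it is an object which a measure on `DefFiberable`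
can measure. -/
theorem Fiberable.exists_fibration_fin {r : ℕ} {X : Set E} (hX : Fiberable L C (r + 1) X) :
    ∃ (n : ℕ) (f : E → (Fin n → M)) (Y : Set (Fin n → M)), IsFibration L C r X f Y := by
  obtain ⟨F, _, f, Y, hf⟩ := hX.exists_fibration
  obtain ⟨n, e, he, he'⟩ := exists_equiv_fin L F
  have hfd := hf.defFun
  have hef : DefFun L fun x => e (f x) := by fun_prop
  refine ⟨n, fun x => e (f x), e '' Y, hX.1, ?_, hef, fun x hx => ⟨_, hf.mapsTo hx, rfl⟩, ?_⟩
  · refine hf.base.of_injOn (hf.base.1.image he) he' e.symm.injective.injOn ?_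
    rintro _ ⟨y, hy, rfl⟩
    simpa using hy
  · exact hf.fibers.of_subset (defPred_fiberFam hX.1 hef) fun y _ =>
      ⟨e.symm y, fun x hx => ⟨hx.1, e.injective (by rw [e.apply_symm_apply]; exact hx.2)⟩⟩

/-- At level 0, `X` is in definable bijection with an object of `Def(C)`, where `hext` fixes the
value. At level `r + 1`, a fibration cuts `X` into pieces over which the fibers have constant
measure; base and fibers are of level `r`, so (F3) determines each piece. -/
theorem IsFubiniMeasure.val_eq_measureSeq (hμ : IsFubiniMeasure (DefOver L C) μ)
    (hC : C.Nontrivial) (hCd : DefPred L (· ∈ C)) (hst : StablyEmbedded L C)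
    {ν : ∀ m, DefFiberable L C m → A} (hν : IsFubiniMeasure (DefFiberable L C) ν)
    (hext : ∀ (m : ℕ) (X : DefSet L M m) (hX : X ∈ DefOver L C m)
      (hX' : X ∈ DefFiberable L C m), ν m ⟨X, hX'⟩ = μ m ⟨X, hX⟩) {r m : ℕ}
    {X : Set (Fin m → M)} (hX : Fiberable L C r X) :
    val ν X = measureSeq L C μ r (Fin m → M) X := by
  have hlow : IsLower (DefFiberable L C) := isLower_defFiberable hC hCd
  have hcls : ∀ {r m : ℕ} {X : Set (Fin m → M)}, Fiberable L C r X →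
    InClass (DefFiberable L C) X := fun h => (inClass_defFiberable_iff hC.nonempty hCd).2 ⟨_, h⟩
  induction r generalizing m with
  | zero =>
    obtain ⟨n, g, hg⟩ := hX.exists_isEmb hC.nonempty
    have hgX := hg.inClass hX.1
    have hgX' := inClass_defOver_iff.1 hgX
    have hgf : Fiberable L C 0 (g '' X) := .of_mem hgX'.1 hgX'.2 0
    have h1 : val ν X = 1 * val ν (g '' X) := by
      refine hν.val_fubini hlow (hcls hX) (hcls hgf) hg.defFun (mapsTo_image g X) ?_
      rintro _ ⟨x, hx, rfl⟩
      have : X ∩ g ⁻¹' {g x} = {x} := by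
        ext z
        simp only [mem_inter_iff, mem_preimage, mem_singleton_iff]
        exact ⟨fun h => hg.injOn h.1 hx h.2, by rintro rfl; exact ⟨hx, rfl⟩⟩
      rw [this, hν.val_singleton (hcls (.singleton hC.nonempty 0 x))]
    have h2 : val ν (g '' X) = val μ (g '' X) := by
      obtain ⟨F, hF⟩ := hgX
      have hF' := defOver_subset_defFiberable hC.nonempty hCd n F.2
      rw [← hF, val_coe, ← hext n F.1 F.2 hF']
      exact val_coe ν ⟨F.1, hF'⟩
    rw [h1, one_mul, h2]
    exact (hμ.baseMeasure_eq hC.nonempty hX.1 hg).symm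
  | succ r ih =>
    have hm := hμ.isMeasure_measureSeq hC.nonempty hCd hst r
    obtain ⟨n, f, Y, hf⟩ := hX.exists_fibration_fin
    have hψ := hf.simple hm
    have hψf := hψ.comp hf.defFun
    have hs := hν.val_sum_pieces hlow (hcls hX) hψf hψ.finite.toFinset
    rw [inter_eq_left.2 fun x _ => by simp] at hs
    refine hs.trans ((?_ : _ = _).trans (hm.stepMeasure_eq hf).symm)
    rw [hm.integ_eq_sum hf.base hψ (s := hψ.finite.toFinset) (by simp)]
    refine Finset.sum_congr rfl fun a _ => ?_
    have hXa := hX.subset (defPred_inter_preimage hX.1 hψf a) inter_subset_left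
    have hYa := hf.base.subset (defPred_inter_preimage hf.base.1 hψ a) inter_subset_left
    rw [← ih hYa]
    refine hν.val_fubini hlow (hcls hXa) (hcls hYa) hf.defFun
      (fun x hx => ⟨hf.mapsTo hx.1, hx.2⟩) fun y hy => ?_
    rw [← show measureSeq L C μ r _ (X ∩ f ⁻¹' {y}) = a from hy.2, ← ih (hf.fiberable y)]
    congr 1
    ext x
    simp only [mem_inter_iff, mem_preimage, mem_singleton_iff]
    refine ⟨fun h => ⟨h.1.1, h.2⟩, fun h => ⟨⟨h.1, ?_⟩, h.2⟩⟩
    rw [h.2]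
    exact (ih (hf.fiberable y)).symm

open Classical in
variable (L C) in
/-- The extension of a measure on `Def(C)` to the fiberable sets. -/
noncomputable def limMeasure (μ : ∀ m, DefOver L C m → A) {m : ℕ} (X : Set (Fin m → M)) : A :=
  if h : ∃ r, Fiberable L C r X then measureSeq L C μ h.choose _ X else 0

theorem IsFubiniMeasure.limMeasure_eq (hμ : IsFubiniMeasure (DefOver L C) μ)
    (hC : C.Nonempty) (hCd : DefPred L (· ∈ C)) (hst : StablyEmbedded L C) {r m : ℕ}
    {X : Set (Fin m → M)} (hX : Fiberable L C r X) :
    limMeasure L C μ X = measureSeq L C μ r _ X := by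
  have h : ∃ r, Fiberable L C r X := ⟨r, hX⟩
  unfold limMeasure
  rw [dif_pos h]
  rcases le_total r h.choose with hr | hr
  · exact hμ.measureSeq_mono hC hCd hst hr hX
  · exact (hμ.measureSeq_mono hC hCd hst hr h.choose_spec).symm

/-- Reduces (F1)–(F3) for `limMeasure` to one level: source and target may need different numbers of
steps, and the larger serves both. -/
theorem IsFubiniMeasure.limMeasure_fibers (hμ : IsFubiniMeasure (DefOver L C) μ)
    (hC : C.Nonempty) (hCd : DefPred L (· ∈ C)) (hst : StablyEmbedded L C)
    {m n : ℕ} (X : DefFiberable L C m) (Y : DefFiberable L C n) {f : X.1 → Y.1}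
    (hf : IsDefMap f) :
    ∃ (r : ℕ) (g : (Fin m → M) → (Fin n → M)),
      Fiberable L C r (X.1 : Set (Fin m → M)) ∧ Fiberable L C r (Y.1 : Set (Fin n → M)) ∧
      DefFun L g ∧ MapsTo g (X.1 : Set (Fin m → M)) Y.1 ∧
      ∀ (y : Y.1) (a : A),
        HasValue (fun m (X : DefFiberable L C m) => limMeasure L C μ (X.1 : Set (Fin m → M)))
          (fiber f y) a ↔ measureSeq L C μ r _ ((X.1 : Set (Fin m → M)) ∩ g ⁻¹' {y.1}) = a := by
  obtain ⟨r, hX⟩ := (mem_defFiberable_iff hCd hC).1 X.2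
  obtain ⟨s, hY⟩ := (mem_defFiberable_iff hCd hC).1 Y.2
  obtain ⟨g, hm, hg, rfl⟩ := exists_eq_restrictMap hf fun _ => hC.some
  have hX := hX.mono (le_max_left r s)
  refine ⟨max r s, g, hX, hY.mono (le_max_right r s), hg, hm, fun y a => ?_⟩
  have hXy : Fiberable L C (max r s) ((X.1 : Set (Fin m → M)) ∩ g ⁻¹' {y.1}) :=
    hX.subset (hX.1.and (DefPred.eq hg (.const y.1))) inter_subset_left
  rw [fiber_restrictMap, ← hμ.limMeasure_eq hC hCd hst hXy]
  constructor
  · rintro ⟨F, hF, rfl⟩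
    exact congrArg _ hF.symm
  · intro h
    exact ⟨⟨⟨_, hXy.1⟩, (mem_defFiberable_iff hCd hC).2 ⟨_, hXy⟩⟩, rfl, h⟩

theorem IsFubiniMeasure.isFubiniMeasure_limMeasure (hμ : IsFubiniMeasure (DefOver L C) μ)
    (hC : C.Nonempty) (hCd : DefPred L (· ∈ C)) (hst : StablyEmbedded L C) :
    IsFubiniMeasure (DefFiberable L C)
      fun m (X : DefFiberable L C m) => limMeasure L C μ (X.1 : Set (Fin m → M)) where
  empty X h := by
    rw [h, hμ.limMeasure_eq hC hCd hst (.of_empty 0),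
      (hμ.isMeasure_measureSeq hC hCd hst 0).empty]
  singleton X v h := by
    rw [h, hμ.limMeasure_eq hC hCd hst (.singleton hC 0 v),
      (hμ.isMeasure_measureSeq hC hCd hst 0).singleton]
  union {m} X Y Z hd h := by
    obtain ⟨r, hZ⟩ := (mem_defFiberable_iff hCd hC).1 Z.2
    have hZe : (Z.1 : Set (Fin m → M)) = (X.1 : Set (Fin m → M)) ∪ (Y.1 : Set (Fin m → M)) := by
      rw [h]
      rfl
    have hX : Fiberable L C r (X.1 : Set (Fin m → M)) :=
      hZ.subset X.1.2 (hZe ▸ subset_union_left)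
    have hY : Fiberable L C r (Y.1 : Set (Fin m → M)) :=
      hZ.subset Y.1.2 (hZe ▸ subset_union_right)
    rw [hμ.limMeasure_eq hC hCd hst hZ, hμ.limMeasure_eq hC hCd hst hX,
      hμ.limMeasure_eq hC hCd hst hY, hZe]
    refine (hμ.isMeasure_measureSeq hC hCd hst r).union (hZe ▸ hZ) hX.1 hY.1 ?_
    refine disjoint_left.2 fun x hx hx' => ?_
    exact (disjoint_iff_inf_le.1 hd) (show x ∈ X.1 ⊓ Y.1 from ⟨hx, hx'⟩)
  finite_values X Y f hf := by
    obtain ⟨r, g, hX, hY, hg, hm, H⟩ := hμ.limMeasure_fibers hC hCd hst X Y hf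
    have hs := (hμ.isMeasure_measureSeq hC hCd hst r).simple (defPred_fiberFam hX.1 hg)
      (hX.uf_fiberFam hg)
    refine hs.finite.subset ?_
    rintro a ⟨y, hy⟩
    exact ⟨y.1, (H y a).1 hy⟩
  definable_values X Y f hf a := by
    obtain ⟨r, g, hX, hY, hg, hm, H⟩ := hμ.limMeasure_fibers hC hCd hst X Y hf
    have hs := (hμ.isMeasure_measureSeq hC hCd hst r).simple (defPred_fiberFam hX.1 hg)
      (hX.uf_fiberFam hg)
    refine defPred_mem_iff.1 ((hY.1.and (hs.def_level a)).congr fun v => ?_)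
    constructor
    · rintro ⟨hv, ha⟩
      exact ⟨⟨v, hv⟩, rfl, (H ⟨v, hv⟩ a).2 ha⟩
    · rintro ⟨y, rfl, ha⟩
      exact ⟨y.2, (H y a).1 ha⟩
  fubini X Y f hf a ha := by
    obtain ⟨r, g, hX, hY, hg, hm, H⟩ := hμ.limMeasure_fibers hC hCd hst X Y hf
    rw [hμ.limMeasure_eq hC hCd hst hX, hμ.limMeasure_eq hC hCd hst hY]
    exact (hμ.isMeasure_measureSeq hC hCd hst r).fubini hX hY hg hm fun y hy =>
      (H ⟨y, hy⟩ a).1 (ha ⟨y, hy⟩)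

theorem defPred_mem_of_definable₁ (hC : (∅ : Set M).Definable₁ L C) : DefPred L (· ∈ C) := by
  have := (hC.mono (empty_subset univ)).preimage_comp (β := Unit) fun _ => ()
  exact this

end

end FubiniExt

theorem theorem1p1 {L : FirstOrder.Language.{u, v}} {M : Type w} [L.Structure M]
    (C : Set M) (hC : (∅ : Set M).Definable₁ L C) (hC₂ : C.Nontrivial)
    (hst : FubiniExt.StablyEmbedded L C) :
    (∀ m, FubiniExt.DefOver L C m ⊆ FubiniExt.DefFiberable L C m) ∧
    FubiniExt.IsAdmissible (FubiniExt.DefFiberable L C) ∧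
    ∀ {A : Type t} [CommSemiring A] (μ : ∀ m, FubiniExt.DefOver L C m → A),
      FubiniExt.IsFubiniMeasure (FubiniExt.DefOver L C) μ →
      ∃! ν : ∀ m, FubiniExt.DefFiberable L C m → A,
        FubiniExt.IsFubiniMeasure (FubiniExt.DefFiberable L C) ν ∧
        ∀ (m : ℕ) (X : FubiniExt.DefSet L M m) (hX : X ∈ FubiniExt.DefOver L C m)
          (hX' : X ∈ FubiniExt.DefFiberable L C m), ν m ⟨X, hX'⟩ = μ m ⟨X, hX⟩ := by
  open FubiniExt in
  have hCd : DefPred L (· ∈ C) := defPred_mem_of_definable₁ hC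
  have hne := hC₂.nonempty
  refine ⟨defOver_subset_defFiberable hne hCd, isAdmissible_defFiberable hC₂ hCd,
    fun {A} _ μ hμ => ⟨fun m X => limMeasure L C μ (X.1 : Set (Fin m → M)),
      ⟨hμ.isFubiniMeasure_limMeasure hne hCd hst, fun m X hX hX' => ?_⟩, ?_⟩⟩
  · have hf : Fiberable L C 0 (X : Set (Fin m → M)) := .of_mem X.2 hX 0
    have hX₀ : DefPred L (· ∈ (X : Set (Fin m → M))) := X.2
    -- On `Def(C)` the identity is an embedding, so the base measure returns `μ` itself.
    have hid : IsEmb L C (X : Set (Fin m → M)) fun x => x := ⟨.id, fun _ _ _ _ h => h, hX⟩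
    refine (hμ.limMeasure_eq hne hCd hst hf).trans ((hμ.baseMeasure_eq hne hX₀ hid).trans ?_)
    rw [Set.image_id']
    exact val_coe μ ⟨X, hX⟩
  · rintro ν ⟨hν, hext⟩
    funext m X
    obtain ⟨r, hr⟩ := (mem_defFiberable_iff hCd hne).1 X.2
    rw [hμ.limMeasure_eq hne hCd hst hr, ← hμ.val_eq_measureSeq hC₂ hCd hst hν hext hr, val_coe]
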